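/- Let $D=[0,\infty)^2$, and let $a_1,a_2,b_{11},b_{22},\sigma_1,\sigma_2>0$ and $b_{12},b_{21}\ge 0$. Put $$A=\begin{pmatrix}a_1\\a_2\end{pmatrix},\qquad B=\begin{pmatrix}b_{11}&-b_{12}\\-b_{21}&b_{22}\end{pmatrix}.$$ For $\lambda\in D$ let $t\mapsto v_t(\lambda)=(v_1(t,\lambda),v_2(t,\lambda))\in D$, $t\ge0$, be the unique solution of $$\partial_t v_1=-b_{11}v_1+b_{12}v_2-\tfrac{\sigma_1^2}{2}v_1^2,\qquad \partial_t v_2=b_{21}v_1-b_{22}v_2-\tfrac{\sigma_2^2}{2}v_2^2,\qquad v_0(\lambda)=\lambda .$$ Let $(Q_t)_{t\ge0}$ be the transition semigroup on $D$ with $$\int_D e^{-\langle y,\lambda\rangle}\,Q_t(x,dy)=\exp\Big\{-\langle x,v_t(\lambda)\rangle-\int_0^t\langle A,v_s(\lambda)\rangle\,ds\Big\},\qquad x,\lambda\in D,\ t\ge 0.$$ Let $X=(X_t)_{t\ge0}$ be a two-type continuous-state branching process with immigration, i.e. a Markov process in $D$ (with respect to its natural filtration) with transition semigroup $(Q_t)_{t\ge0}$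 and an arbitrary initial distribution, defined on a probability space with probability measure $\mathbf P$. Equip the path space $D^{[0,\infty)}$ with the product $\sigma$-algebra, and let $(\theta_tw)(s)=w(t+s)$ be the time shifts on it. **Corollary 2.3.** Suppose that both eigenvalues of $B$ are positive, i.e. $b_{12}b_{21}<b_{11}b_{22}$. Then: 1. $X$ is mixing: for all measurable sets $C,E\subseteq D^{[0,\infty)}$, $$\mathbf P(X\in C,\ \theta_tX\in E)-\mathbf P(X\in C)\,\mathbf P(\theta_tX\in E)\to0\qquad(t\to\infty).$$ In particular, if the distribution of $X_0$ is stationary for $(Q_t)_{t\ge0}$, then the law of $X$ on path space is preserved by every $\theta_t$, and it is mixing in the sense of ergodic theory: $\mathbf P(X\in C,\ \theta_tX\in E)\to\mathbf P(X\in C)\,\mathbf P(X\in E)$ as $t\to\infty$ for all measurable $C,E$. 2. The tail $\sigma$-algebra $\bigcap_{t\ge0}\sigma(X_s:s\ge t)$ is trivial: each of its events has probability $0$ or $1$. -/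

import Mathlib

open MeasureTheory ProbabilityTheory Filter Topology
open scoped NNReal

namespace TwoTypeCBI

/-- The state space `D = [0, ∞)²`, with its Borel σ-algebra. -/
abbrev State : Type := Fin 2 → ℝ≥0

/-- The pairing `⟨x, l⟩ = x₁ l₁ + x₂ l₂`, where `x` lies in `D`. -/
def pairing (x : State) (l : Fin 2 → ℝ) : ℝ := (x 0 : ℝ) * l 0 + (x 1 : ℝ) * l 1

/-- The parameters
`(a₁, a₂, b₁₁, b₁₂, b₂₁, b₂₂, σ₁, σ₂) ∈ (0, ∞)³ × [0, ∞)² × (0, ∞)³`. -/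
structure Params where
  a₁ : ℝ
  a₂ : ℝ
  b₁₁ : ℝ
  b₁₂ : ℝ
  b₂₁ : ℝ
  b₂₂ : ℝ
  σ₁ : ℝ
  σ₂ : ℝ
  a₁_pos : 0 < a₁
  a₂_pos : 0 < a₂
  b₁₁_pos : 0 < b₁₁
  b₁₂_nonneg : 0 ≤ b₁₂
  b₂₁_nonneg : 0 ≤ b₂₁
  b₂₂_pos : 0 < b₂₂
  σ₁_pos : 0 < σ₁
  σ₂_pos : 0 < σ₂

/-- The drift matrix `B`. -/
def Params.B (θ : Params) : Matrix (Fin 2) (Fin 2) ℝ :=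
  !![θ.b₁₁, -θ.b₁₂; -θ.b₂₁, θ.b₂₂]

/-- The branching mechanism `(φ₁, φ₂)`. -/
noncomputable def Params.φ (θ : Params) (l : Fin 2 → ℝ) : Fin 2 → ℝ :=
  ![θ.b₁₁ * l 0 - θ.b₁₂ * l 1 + θ.σ₁ ^ 2 / 2 * l 0 ^ 2,
    -θ.b₂₁ * l 0 + θ.b₂₂ * l 1 + θ.σ₂ ^ 2 / 2 * l 1 ^ 2]

/-- `v t l = v_t(l)` (for `t ≥ 0`, `l ∈ D`) is the `D`-valued solution of
`∂v_t(l)/∂t = -φ(v_t(l))`, `v_0(l) = l`, the derivative at `t = 0` being one-sided. -/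
structure Params.IsCumulantFlow (θ : Params) (v : ℝ → State → Fin 2 → ℝ) : Prop where
  initial : ∀ (l : State) (i : Fin 2), v 0 l i = (l i : ℝ)
  nonneg : ∀ (l : State) (t : ℝ), 0 ≤ t → ∀ i, 0 ≤ v t l i
  ode : ∀ (l : State) (t : ℝ), 0 ≤ t →
    HasDerivWithinAt (fun s => v s l) (-θ.φ (v t l)) (Set.Ici 0) t

/-- `(Q_t)_{t ≥ 0}` is the transition semigroup of the two-type CBI-process with parameters `θ`:
a semigroup of Markov kernels on `D` with the Laplace transforms
`∫ e^{-⟨y,l⟩} Q_t(x,dy) = exp(-⟨x, v_t(l)⟩ - ∫₀ᵗ ⟨A, v_s(l)⟩ ds)`, where `A = (a₁, a₂)`. -/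
structure Params.IsTransitionSemigroup (θ : Params) (Q : ℝ≥0 → Kernel State State) : Prop where
  markov : ∀ t, IsMarkovKernel (Q t)
  zero : Q 0 = Kernel.id
  add : ∀ s t, Q (s + t) = Q t ∘ₖ Q s
  laplace : ∃ v, θ.IsCumulantFlow v ∧ ∀ (t : ℝ≥0) (x l : State),
    ∫ y, Real.exp (-pairing y (fun i => (l i : ℝ))) ∂(Q t x) =
      Real.exp (-pairing x (v t l) - ∫ s in (0 : ℝ)..t, (θ.a₁ * v s l 0 + θ.a₂ * v s l 1))

variable {Ω : Type*}

/-- `σ(X_r : r ≤ s)`. -/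
@[reducible] def past (X : ℝ≥0 → Ω → State) (s : ℝ≥0) : MeasurableSpace Ω :=
  ⨆ r : ℝ≥0, ⨆ _ : r ≤ s, MeasurableSpace.comap (X r) inferInstance

/-- The tail σ-algebra `⋂_{t ≥ 0} σ(X_s : s ≥ t)`. -/
@[reducible] def tail (X : ℝ≥0 → Ω → State) : MeasurableSpace Ω :=
  ⨅ t : ℝ≥0, ⨆ s : ℝ≥0, ⨆ _ : t ≤ s, MeasurableSpace.comap (X s) inferInstance

/-- Under `P`, `X` is a Markov process in `D` with transition semigroup `(Q_t)`, with an arbitrary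
initial distribution: `P(X_{s+t} ∈ C | X_r, r ≤ s) = Q_t(X_s, C)` almost surely. -/
structure IsMarkovProcess [MeasurableSpace Ω] (P : Measure Ω) (Q : ℝ≥0 → Kernel State State)
    (X : ℝ≥0 → Ω → State) : Prop where
  measurable : ∀ t, Measurable (X t)
  transition : ∀ (s t : ℝ≥0) (C : Set State), MeasurableSet C →
    P[(X (s + t) ⁻¹' C).indicator (fun _ => (1 : ℝ)) | past X s]
      =ᵐ[P] fun ω => (Q t (X s ω)).real C

/-- The path `t ↦ X_t(ω)`. The path space `ℝ≥0 → D` carries the product σ-algebra. -/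
def path (X : ℝ≥0 → Ω → State) (ω : Ω) : ℝ≥0 → State := fun t => X t ω

/-- The time shift `(θ_t w)(s) = w(t + s)` on path space. -/
def shift (t : ℝ≥0) (w : ℝ≥0 → State) : ℝ≥0 → State := fun s => w (t + s)

/-- Mixing of a process with an arbitrary initial distribution: for all measurable sets of paths
`C`, `E`, `P(X ∈ C, θ_t X ∈ E) - P(X ∈ C) P(θ_t X ∈ E) → 0` as `t → ∞`. -/
def IsMixing [MeasurableSpace Ω] (P : Measure Ω) (X : ℝ≥0 → Ω → State) : Prop :=
  ∀ C E : Set (ℝ≥0 → State), MeasurableSet C → MeasurableSet E →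
    Tendsto (fun t : ℝ≥0 =>
      P.real {ω | path X ω ∈ C ∧ shift t (path X ω) ∈ E} -
        P.real {ω | path X ω ∈ C} * P.real {ω | shift t (path X ω) ∈ E}) atTop (𝓝 0)

/-- Mixing in the sense of ergodic theory, for a law `μ` on path space: the time shifts preserve
`μ`, and `μ(C ∩ θ_t⁻¹ E) → μ(C) μ(E)` as `t → ∞` for all measurable `C`, `E`. -/
def IsShiftMixing (μ : Measure (ℝ≥0 → State)) : Prop :=
  (∀ t, MeasurePreserving (shift t) μ μ) ∧
    ∀ C E : Set (ℝ≥0 → State), MeasurableSet C → MeasurableSet E →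
      Tendsto (fun t : ℝ≥0 => μ (C ∩ shift t ⁻¹' E)) atTop (𝓝 (μ C * μ E))

end TwoTypeCBI

namespace TwoTypeCBI

/-! ### Laplace transforms of measures on the quadrant: uniqueness and continuity. -/

section Laplace

open BoundedContinuousFunction

/-! Everything rests on the transition laws forgetting their starting point in total variation. The
Laplace transform of `Q t x` factors, so `Q t x = ν ∗ Q t 0`, where `ν` is the law at time `t` of
the branching process without immigration started from `x`. When `det B > 0` a Riccati comparison
bounds `v t l` by `C / t` uniformly in `l` (`exists_le_div`). Letting `l → ∞` in the transform of
`ν` shows that `ν` has an atom at `0` of mass at least `exp (-(x₁ + x₂) C / t)`, so `Q t x` and `Q t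
0` differ by at most one minus this (`exists_abs_lintegral_sub_le`).

The hypotheses supply only `Q` and the flow `v`, so `ν` has to be constructed (`exists_measure`). An
Euler scheme for `∂v/∂t = -φ(v)` is chosen so that each step is itself the cumulant map of a Markov
kernel, a deterministic linear map combined with Poisson sampling. Its iterates converge to `v t`,
and tightness yields a limiting measure.

By the Markov property, the conditional probability of a future event after `t` given the past up to
`s` is `Q (t - s)` applied to a `[0, 1]`-valued function and evaluated at `X s`. It is therefore
almost constant for large `t`, uniformly over the future events (`abs_measureReal_inter_sub_le`). A
Dynkin class argument replaces the past event by any event of the process. A fixed future set gives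
mixing; because of the uniformity the set may also vary with `t`, so a tail event can be tested
against itself, giving `P(E) = P(E)²`. -/

lemma pairing_nonneg (x : State) {l : Fin 2 → ℝ} (hl : ∀ i, 0 ≤ l i) : 0 ≤ pairing x l :=
  add_nonneg (mul_nonneg (x 0).2 (hl 0)) (mul_nonneg (x 1).2 (hl 1))

lemma pairing_coe_nonneg (x l : State) : 0 ≤ pairing x (fun i => (l i : ℝ)) :=
  pairing_nonneg x fun i => (l i).2

lemma continuous_pairing (l : Fin 2 → ℝ) : Continuous fun x : State => pairing x l := by
  unfold pairing
  fun_prop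

lemma pairing_add_left (x y : State) (l : Fin 2 → ℝ) :
    pairing (x + y) l = pairing x l + pairing y l := by
  simp only [pairing, Pi.add_apply, NNReal.coe_add]
  ring

/-- The bounded continuous function `y ↦ e^{-⟨y, l⟩}`. -/
noncomputable def expPairing (l : State) : State →ᵇ ℝ :=
  BoundedContinuousFunction.ofNormedAddCommGroup
    (fun y => Real.exp (-pairing y (fun i => (l i : ℝ))))
    (Real.continuous_exp.comp (continuous_pairing _).neg) 1
    (fun y => by
      rw [Real.norm_eq_abs, Real.abs_exp, Real.exp_le_one_iff]
      linarith [pairing_coe_nonneg y l])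

lemma expPairing_apply (l y : State) :
    expPairing l y = Real.exp (-pairing y (fun i => (l i : ℝ))) := rfl

lemma expPairing_pos (l y : State) : 0 < expPairing l y := Real.exp_pos _

lemma expPairing_le_one (l y : State) : expPairing l y ≤ 1 := by
  rw [expPairing_apply, Real.exp_le_one_iff]
  linarith [pairing_coe_nonneg y l]

lemma expPairing_add (l l' : State) : expPairing (l + l') = expPairing l * expPairing l' := by
  ext y
  simp only [expPairing_apply, BoundedContinuousFunction.mul_apply, ← Real.exp_add, pairing,
    Pi.add_apply, NNReal.coe_add]
  congr 1
  ring

lemma expPairing_zero : expPairing 0 = 1 := by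
  ext y
  simp [expPairing_apply, pairing]

/-- The functions `e^{-⟨·, l⟩}` form a submonoid. -/
noncomputable def expSubmonoid : Submonoid (State →ᵇ ℝ) where
  carrier := Set.range expPairing
  mul_mem' := by
    rintro _ _ ⟨l, rfl⟩ ⟨l', rfl⟩
    exact ⟨l + l', expPairing_add l l'⟩
  one_mem' := ⟨0, expPairing_zero⟩

/-- The algebra of exponential polynomials on the state space. -/
noncomputable def expAlgebra : StarSubalgebra ℝ (State →ᵇ ℝ) :=
  { Algebra.adjoin ℝ (Set.range expPairing) with
    star_mem' := fun {a} ha => by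
      have : star a = a := by ext; simp
      rw [this]; exact ha }

/-- Products of exponentials are exponentials, so the generated algebra is already their linear
span. Equality of integrals then needs checking only for sums and scalar multiples. -/
lemma mem_expAlgebra_iff (g : State →ᵇ ℝ) :
    g ∈ expAlgebra ↔ g ∈ Submodule.span ℝ (Set.range expPairing) := by
  have h : Submonoid.closure (Set.range expPairing) = expSubmonoid :=
    Submonoid.closure_eq expSubmonoid
  have h2 := Algebra.adjoin_eq_span ℝ (Set.range expPairing)
  rw [h] at h2
  change g ∈ Subalgebra.toSubmodule (Algebra.adjoin ℝ (Set.range expPairing)) ↔ _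
  rw [h2]
  rfl

lemma expAlgebra_separatesPoints :
    (expAlgebra.map (toContinuousMapStarₐ ℝ)).SeparatesPoints := by
  intro x y hxy
  obtain ⟨i, hi⟩ := Function.ne_iff.1 hxy
  refine ⟨expPairing (Pi.single i 1), ⟨toContinuousMapStarₐ ℝ (expPairing (Pi.single i 1)),
    ⟨_, (mem_expAlgebra_iff _).2 (Submodule.subset_span ⟨_, rfl⟩), rfl⟩, rfl⟩, ?_⟩
  intro h
  apply hi
  simp only [expPairing_apply, Real.exp_eq_exp, neg_inj, pairing] at h
  fin_cases i <;> simpa using h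

/-- A finite measure on the state space is determined by its Laplace transform. -/
lemma ext_of_laplace {μ ν : Measure State} [IsFiniteMeasure μ] [IsFiniteMeasure ν]
    (h : ∀ l, ∫ y, expPairing l y ∂μ = ∫ y, expPairing l y ∂ν) : μ = ν := by
  -- A point-separating star subalgebra of bounded continuous functions determines finite measures
  -- on a Polish space, by Stone–Weierstrass.
  refine ext_of_forall_mem_subalgebra_integral_eq_of_polish expAlgebra_separatesPoints
    fun g hg => ?_
  rw [mem_expAlgebra_iff] at hg
  induction hg using Submodule.span_induction with
  | mem g hg => obtain ⟨l, rfl⟩ := hg; exact h l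
  | zero => simp
  | add f g _ _ hf hg =>
    simp only [BoundedContinuousFunction.add_apply]
    rw [integral_add (f.integrable _) (g.integrable _),
      integral_add (f.integrable _) (g.integrable _), hf, hg]
  | smul c f _ hf =>
    simp only [BoundedContinuousFunction.smul_apply]
    rw [integral_smul, integral_smul, hf]

/-- `exp (-n (y₁ + y₂))` decreases to the indicator of the origin. This reads off the atom at `0`
from the Laplace transform. -/
lemma tendsto_integral_expPairing_atTop (μ : Measure State) [IsProbabilityMeasure μ] :
    Tendsto (fun n : ℕ => ∫ y, expPairing (fun _ => (n : ℝ≥0)) y ∂μ) atTop (𝓝 (μ.real {0})) := by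
  have h : ∫ y, ({0} : Set State).indicator (fun _ => (1 : ℝ)) y ∂μ = μ.real {0} := by
    rw [integral_indicator (measurableSet_singleton _)]
    simp [measureReal_def]
  rw [← h]
  refine tendsto_integral_of_dominated_convergence (fun _ => 1)
    (fun n => (expPairing _).continuous.aestronglyMeasurable) (integrable_const 1)
    (fun n => ae_of_all _ fun y => ?_) (ae_of_all _ fun y => ?_)
  · rw [Real.norm_of_nonneg (expPairing_pos _ y).le]
    exact expPairing_le_one _ y
  · by_cases hy : y = 0
    · subst hy
      simp [expPairing_apply, pairing]
    · rw [Set.indicator_of_notMem (by simpa using hy)]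
      have hpos : 0 < (y 0 : ℝ) + y 1 := by
        obtain ⟨i, hi⟩ := Function.ne_iff.1 hy
        have hi' : 0 < (y i : ℝ) := NNReal.coe_pos.2 (pos_iff_ne_zero.2 hi)
        have h0 := (y 0).2
        have h1 := (y 1).2
        fin_cases i
        · exact add_pos_of_pos_of_nonneg hi' h1
        · exact add_pos_of_nonneg_of_pos h0 hi'
      have : Tendsto (fun n : ℕ => Real.exp (-((n : ℝ) * ((y 0 : ℝ) + y 1)))) atTop (𝓝 0) :=
        Real.tendsto_exp_neg_atTop_nhds_zero.comp
          (tendsto_natCast_atTop_atTop.atTop_mul_const hpos)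
      refine this.congr fun n => ?_
      rw [expPairing_apply, pairing]
      congr 1
      simp only [NNReal.coe_natCast]
      ring

/-- A bound on the Laplace transform near the origin bounds the tails of the measure. -/
lemma measureReal_compl_le_of_laplace (μ : Measure State) [IsProbabilityMeasure μ] {δ : ℝ≥0}
    (hδ : 0 < δ) {ε : ℝ} (h : 1 - ε ≤ ∫ y, expPairing (fun _ => δ) y ∂μ) :
    μ.real {y : State | ∀ i, y i ≤ δ⁻¹}ᶜ ≤ 2 * ε := by
  set f : State → ℝ := fun y => 1 - expPairing (fun _ => δ) y
  have hf : Integrable f μ := (integrable_const 1).sub ((expPairing _).integrable μ)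
  have hf0 : ∀ y, 0 ≤ f y := fun y => sub_nonneg.2 (expPairing_le_one _ y)
  -- Markov's inequality at level `1/2`: outside the box the pairing is at least `1`, and `1 - exp
  -- (-1) ≥ 1/2`. This is the source of the factor `2`.
  have h1 := mul_meas_ge_le_integral_of_nonneg (ae_of_all μ hf0) hf (1 / 2)
  have h2 : ∫ y, f y ∂μ ≤ ε := by
    rw [integral_sub (integrable_const 1) ((expPairing _).integrable μ)]
    simp only [integral_const, probReal_univ, smul_eq_mul, one_mul]
    linarith
  have h3 : μ.real {y : State | ∀ i, y i ≤ δ⁻¹}ᶜ ≤ μ.real {y | 1 / 2 ≤ f y} := by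
    refine measureReal_mono fun y hy => ?_
    simp only [Set.mem_compl_iff, Set.mem_ofPred_eq, not_forall, not_le] at hy ⊢
    obtain ⟨i, hi⟩ := hy
    have hδ' : (0 : ℝ) < δ := hδ
    have hi' : 1 ≤ (y i : ℝ) * δ := by
      have : (δ : ℝ)⁻¹ < y i := by exact_mod_cast hi
      rw [inv_lt_iff_one_lt_mul₀ hδ'] at this
      linarith
    have hp : 1 ≤ pairing y (fun _ => (δ : ℝ)) := by
      have h0 : 0 ≤ (y 0 : ℝ) * δ := by positivity
      have h1 : 0 ≤ (y 1 : ℝ) * δ := by positivity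
      unfold pairing
      fin_cases i
      · simp only [Fin.zero_eta] at hi'
        linarith
      · simp only [Fin.mk_one] at hi'
        linarith
    have he : Real.exp (-pairing y (fun _ => (δ : ℝ))) ≤ 1 / 2 := by
      have h2 : Real.exp 1 ≤ Real.exp (pairing y (fun _ => (δ : ℝ))) := Real.exp_le_exp.2 hp
      have h3 := Real.add_one_le_exp (1 : ℝ)
      rw [Real.exp_neg, one_div]
      exact inv_anti₀ (by norm_num) (by linarith)
    change 1 / 2 ≤ 1 - Real.exp (-pairing y (fun _ => (δ : ℝ)))
    linarith
  linarith

/-- Continuity theorem for Laplace transforms: a pointwise limit of Laplace transforms of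
probability measures that are uniformly close to `1` near the origin is the Laplace transform of a
probability measure. -/
lemma exists_measure_of_tendsto_laplace (μ : ℕ → Measure State)
    [hμ : ∀ n, IsProbabilityMeasure (μ n)] (F : State → ℝ)
    (hF : ∀ l, Tendsto (fun n => ∫ y, expPairing l y ∂(μ n)) atTop (𝓝 (F l)))
    (hzero : ∀ ε > 0, ∃ δ : ℝ≥0, 0 < δ ∧ ∀ n, 1 - ε ≤ ∫ y, expPairing (fun _ => δ) y ∂(μ n)) :
    ∃ ν : Measure State, IsProbabilityMeasure ν ∧ ∀ l, ∫ y, expPairing l y ∂ν = F l := by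
  set m : ℕ → ProbabilityMeasure State := fun n => ⟨μ n, hμ n⟩
  have htight : IsTightMeasureSet {((ρ : ProbabilityMeasure State) : Measure State) |
      ρ ∈ Set.range m} := by
    rw [isTightMeasureSet_iff_exists_isCompact_measure_compl_le]
    intro ε hε
    obtain ⟨η, hη, hηε⟩ : ∃ η : ℝ, 0 < η ∧ ENNReal.ofReal (2 * η) ≤ ε := by
      rcases eq_or_ne ε ⊤ with rfl | htop
      · exact ⟨1, one_pos, le_top⟩
      · refine ⟨ε.toReal / 2, half_pos (ENNReal.toReal_pos hε.ne' htop), ?_⟩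
        rw [mul_div_cancel₀ _ two_ne_zero, ENNReal.ofReal_toReal htop]
    obtain ⟨δ, hδ, h⟩ := hzero η hη
    refine ⟨{y : State | ∀ i, y i ≤ δ⁻¹}, ?_, ?_⟩
    · have : {y : State | ∀ i, y i ≤ δ⁻¹} = Set.Icc 0 (fun _ => δ⁻¹) := by
        ext y
        simp [Pi.le_def]
      rw [this]
      exact isCompact_Icc
    · rintro _ ⟨_, ⟨n, rfl⟩, rfl⟩
      have := measureReal_compl_le_of_laplace (μ n) hδ (h n)
      refine le_trans ?_ hηε
      rw [← ofReal_measureReal]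
      exact ENNReal.ofReal_le_ofReal this
  have hcomp := isCompact_closure_of_isTightMeasureSet htight
  -- By Prokhorov the laws converge along a nonprincipal ultrafilter, so no subsequence is needed.
  -- The transforms converge along the whole sequence, which identifies those of the limit.
  set U : Ultrafilter ℕ := Filter.hyperfilter ℕ
  have hU : (U : Filter ℕ) ≤ atTop := Nat.hyperfilter_le_atTop
  obtain ⟨ν, -, hν⟩ := hcomp.ultrafilter_le_nhds (U.map m)
    (.trans (by simp) (monotone_principal subset_closure))
  have hν' : Tendsto m U (𝓝 ν) := hν
  refine ⟨ν, inferInstance, fun l => ?_⟩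
  rw [ProbabilityMeasure.tendsto_iff_forall_integral_tendsto] at hν'
  exact tendsto_nhds_unique (hν' (expPairing l)) ((hF l).mono_left hU)

end Laplace

/-! ### Branching kernels and their cumulant maps. -/

section Branching

/-- `ψ` is the cumulant map of a branching transition kernel:
`∫ e^{-⟨y, l⟩} K(x, dy) = e^{-⟨x, ψ(l)⟩}`. -/
def IsBranching (ψ : State → State) : Prop :=
  ∃ K : Kernel State State, IsMarkovKernel K ∧
    ∀ x l, ∫ y, expPairing l y ∂(K x) = expPairing (ψ l) x

/-- Cumulant maps compose in the reverse order of the transitions: the kernel of `ψ` acts first,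
then that of `χ`. -/
lemma IsBranching.comp {ψ χ : State → State} (hψ : IsBranching ψ) (hχ : IsBranching χ) :
    IsBranching (ψ ∘ χ) := by
  obtain ⟨K, _, hKψ⟩ := hψ
  obtain ⟨J, _, hJχ⟩ := hχ
  refine ⟨J ∘ₖ K, inferInstance, fun x l => ?_⟩
  rw [Kernel.integral_comp ((expPairing l).integrable _)]
  simp_rw [hJχ, hKψ]
  rfl

lemma isBranching_id : IsBranching id := by
  refine ⟨Kernel.id, inferInstance, fun x l => ?_⟩
  rw [Kernel.id_apply, integral_dirac]
  rfl

lemma IsBranching.iterate {ψ : State → State} (hψ : IsBranching ψ) (n : ℕ) :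
    IsBranching ψ^[n] := by
  induction n with
  | zero => exact isBranching_id
  | succ n ih => exact ih.comp hψ

/-- The linear map with nonnegative matrix `m`. -/
def linMap (m : Fin 2 → Fin 2 → ℝ≥0) (l : State) : State := fun i => m i 0 * l 0 + m i 1 * l 1

/-- Since `⟨x, m l⟩ = ⟨mᵀ x, l⟩`, the kernel is the deterministic motion by the transposed matrix.
-/
lemma isBranching_linMap (m : Fin 2 → Fin 2 → ℝ≥0) : IsBranching (linMap m) := by
  have hm : Measurable fun (x : State) (j : Fin 2) => x 0 * m 0 j + x 1 * m 1 j := by fun_prop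
  refine ⟨Kernel.deterministic _ hm, inferInstance, fun x l => ?_⟩
  rw [Kernel.deterministic_apply, integral_dirac]
  simp only [expPairing_apply, pairing, linMap]
  congr 1
  push_cast
  ring

lemma measurable_poissonMeasure : Measurable poissonMeasure := by
  refine Measure.measurable_of_measurable_coe _ fun s hs => ?_
  simp only [poissonMeasure]
  simp_rw [Measure.sum_apply _ hs, Measure.smul_apply]
  refine Measurable.tsum fun n => ?_
  refine Measurable.mul_const ?_ _
  fun_prop

/-- The Poisson distribution as a kernel from its parameter. -/
noncomputable def poissonKernel : Kernel ℝ≥0 ℕ := ⟨poissonMeasure, measurable_poissonMeasure⟩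

instance : IsMarkovKernel poissonKernel :=
  ⟨fun r => inferInstanceAs (IsProbabilityMeasure (poissonMeasure r))⟩

lemma integral_exp_poissonMeasure (r : ℝ≥0) (u : ℝ) :
    ∫ n, Real.exp (-(n * u)) ∂(poissonMeasure r) = Real.exp (-(r * (1 - Real.exp (-u)))) := by
  rw [integral_poissonMeasure]
  have h := (NormedSpace.expSeries_div_hasSum_exp ((r : ℝ) * Real.exp (-u))).mul_left
    (Real.exp (-r))
  rw [← Real.exp_eq_exp_ℝ, ← Real.exp_add] at h
  convert! h.tsum_eq using 1
  · refine tsum_congr fun n => ?_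
    rw [mul_pow, ← Real.exp_nat_mul, smul_eq_mul]
    have : -(n * u) = n * -u := by ring
    rw [this]
    ring
  · congr 1
    ring

/-- The cumulant map of the kernel which replaces the masses `xᵢ` by independent Poisson multiples
of `cᵢ` with means `xᵢ`. -/
noncomputable def poissonMap (c : Fin 2 → ℝ≥0) (l : State) : State :=
  fun i => Real.toNNReal ((1 - Real.exp (-(c i * l i))) / c i)

lemma coe_poissonMap (c : Fin 2 → ℝ≥0) (l : State) (i : Fin 2) :
    (poissonMap c l i : ℝ) = (1 - Real.exp (-(c i * l i))) / c i := by
  refine Real.coe_toNNReal _ (div_nonneg ?_ (c i).2)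
  rw [sub_nonneg, Real.exp_le_one_iff, neg_nonpos]
  exact mul_nonneg (c i).2 (l i).2

/-- The number of atoms of size `c i` is Poisson with mean `x i / c i`, independently for the two
types. If `c i = 0`, the convention `a / 0 = 0` makes both this mean and the cumulant vanish, so the
identity persists. -/
lemma isBranching_poissonMap (c : Fin 2 → ℝ≥0) : IsBranching (poissonMap c) := by
  have h0 : Measurable fun x : State => x 0 / c 0 := by fun_prop
  have h1 : Measurable fun x : State => x 1 / c 1 := by fun_prop
  have hg : Measurable fun p : ℕ × ℕ => (![c 0 * p.1, c 1 * p.2] : State) :=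
    .of_discrete
  refine ⟨((poissonKernel.comap _ h0) ×ₖ (poissonKernel.comap _ h1)).map
    (fun p : ℕ × ℕ => (![c 0 * p.1, c 1 * p.2] : State)),
    Kernel.IsMarkovKernel.map _ hg, fun x l => ?_⟩
  rw [Kernel.map_apply _ hg, integral_map hg.aemeasurable
    (expPairing l).continuous.aestronglyMeasurable, Kernel.prod_apply, Kernel.comap_apply,
    Kernel.comap_apply]
  have h : ∀ p : ℕ × ℕ, expPairing l ![c 0 * p.1, c 1 * p.2] =
      Real.exp (-(p.1 * (c 0 * l 0 : ℝ))) * Real.exp (-(p.2 * (c 1 * l 1 : ℝ))) := by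
    intro p
    rw [expPairing_apply, pairing, ← Real.exp_add]
    congr 1
    simp only [Matrix.cons_val_zero, Matrix.cons_val_one, NNReal.coe_mul, NNReal.coe_natCast]
    ring
  simp_rw [h]
  rw [integral_prod_mul (fun n : ℕ => Real.exp (-(n * (c 0 * l 0 : ℝ))))
    (fun n : ℕ => Real.exp (-(n * (c 1 * l 1 : ℝ))))]
  change (∫ n, _ ∂(poissonMeasure _)) * (∫ n, _ ∂(poissonMeasure _)) = _
  rw [integral_exp_poissonMeasure, integral_exp_poissonMeasure, ← Real.exp_add, expPairing_apply,
    pairing, coe_poissonMap, coe_poissonMap]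
  congr 1
  push_cast
  ring

end Branching

/-! ### Elementary estimates for the exponential. -/

section Scalar

lemma abs_exp_neg_sub_le {u : ℝ} (hu : 0 ≤ u) :
    |1 - Real.exp (-u) - u + u ^ 2 / 2| ≤ u ^ 3 / 6 := by
  have key : ∀ u : ℝ, 0 ≤ u → Real.exp (-u) ≤ 1 - u + u ^ 2 / 2 := by
    intro u hu
    have h := Real.quadratic_le_exp_of_nonneg hu
    rw [Real.exp_neg]
    -- The point is `(1 - u + u²/2)(1 + u + u²/2) = 1 + u⁴/4 ≥ 1`.
    refine inv_le_of_inv_le₀ (by nlinarith [sq_nonneg (u - 1)]) (le_trans ?_ h)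
    rw [inv_le_iff_one_le_mul₀ (by nlinarith [sq_nonneg (u - 1)])]
    nlinarith [sq_nonneg (u ^ 2)]
  have hd : ∀ x : ℝ, HasDerivAt (fun u : ℝ => Real.exp (-u) - 1 + u - u ^ 2 / 2 + u ^ 3 / 6)
      (-Real.exp (-x) + 1 - x + x ^ 2 / 2) x := by
    intro x
    have h := (((((hasDerivAt_id x).neg.exp).sub_const 1).add (hasDerivAt_id x)).sub
      (((hasDerivAt_id x).pow 2).div_const 2)).add (((hasDerivAt_id x).pow 3).div_const 6)
    convert! h using 1
    simp
    ring
  have hmono : MonotoneOn (fun u : ℝ => Real.exp (-u) - 1 + u - u ^ 2 / 2 + u ^ 3 / 6)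
      (Set.Ici 0) := by
    refine monotoneOn_of_deriv_nonneg (convex_Ici 0)
      (fun x _ => (hd x).continuousAt.continuousWithinAt)
      (fun x _ => (hd x).differentiableAt.differentiableWithinAt) fun x hx => ?_
    rw [interior_Ici, Set.mem_Ioi] at hx
    rw [(hd x).deriv]
    linarith [key x hx.le]
  have h := hmono Set.self_mem_Ici hu hu
  simp only [neg_zero, Real.exp_zero] at h
  have h2 := key u hu
  have h3 : 0 ≤ u ^ 3 := by positivity
  rw [abs_le]
  constructor <;> norm_num at h ⊢ <;> linarith

/-- With `c = h σ²`, the Poisson cumulant reproduces the branching term `-h σ²/2 y²` of an Euler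
step up to `O(h²)`. -/
lemma abs_one_sub_exp_div_sub_le {c y : ℝ} (hc : 0 < c) (hy : 0 ≤ y) :
    |(1 - Real.exp (-(c * y))) / c - (y - c / 2 * y ^ 2)| ≤ c ^ 2 * y ^ 3 / 6 := by
  have h := abs_exp_neg_sub_le (mul_nonneg hc.le hy)
  have h1 : (1 - Real.exp (-(c * y))) / c - (y - c / 2 * y ^ 2) =
      (1 - Real.exp (-(c * y)) - c * y + (c * y) ^ 2 / 2) / c := by
    field_simp
    ring
  rw [h1, abs_div, abs_of_pos hc, div_le_iff₀ hc]
  calc _ ≤ _ := h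
    _ = _ := by ring

/-- The slope `exp (-c y)` is at most `1`. Poisson sampling is thus nonexpansive on cumulants, and
only the linear part enters the stability constant of the scheme. -/
lemma abs_one_sub_exp_div_sub_le_abs {c y z : ℝ} (hc : 0 < c) (hy : 0 ≤ y) (hz : 0 ≤ z) :
    |(1 - Real.exp (-(c * y))) / c - (1 - Real.exp (-(c * z))) / c| ≤ |y - z| := by
  wlog hyz : y ≤ z generalizing y z
  · rw [abs_sub_comm, abs_sub_comm y]
    exact this hz hy (le_of_not_ge hyz)
  rw [← sub_div, abs_div, abs_of_pos hc, div_le_iff₀ hc, abs_sub_comm y, abs_of_nonneg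
    (sub_nonneg.2 hyz)]
  have hcyz : c * y ≤ c * z := mul_le_mul_of_nonneg_left hyz hc.le
  have h1 : Real.exp (-(c * z)) ≤ Real.exp (-(c * y)) := Real.exp_le_exp.2 (by linarith)
  have h2 : Real.exp (-(c * z)) = Real.exp (-(c * y)) * Real.exp (-(c * z - c * y)) := by
    rw [← Real.exp_add]; congr 1; ring
  have h3 := Real.add_one_le_exp (-(c * z - c * y))
  have h4 : Real.exp (-(c * y)) ≤ 1 := by
    rw [Real.exp_le_one_iff, neg_nonpos]; exact mul_nonneg hc.le hy
  have h5 := Real.exp_pos (-(c * y))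
  rw [abs_le]
  constructor
  · nlinarith
  · nlinarith

end Scalar

/-! ### The positivity preserving Euler scheme: consistency and stability. -/

section Euler

/-- The scalar Euler step: consistency of order two for one coordinate. -/
lemma abs_step_sub_le {h s d o R x z : ℝ} (hh : 0 < h) (hh1 : h ≤ 1) (hs : 0 < s) (hd : 0 ≤ d)
    (ho : 0 ≤ o) (hhd : h * d ≤ 1) (hx : 0 ≤ x) (hz : 0 ≤ z) (hxR : x ≤ R) (hzR : z ≤ R) :
    |(1 - Real.exp (-(h * s * ((1 - h * d) * x + h * o * z)))) / (h * s) -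
      (x - h * (d * x - o * z + s / 2 * x ^ 2))| ≤
      (s / 2 * ((d + o) * (2 + o)) * R ^ 2 + s ^ 2 * ((1 + o) * R) ^ 3 / 6) * h ^ 2 := by
  have hR : 0 ≤ R := hx.trans hxR
  set y := (1 - h * d) * x + h * o * z with hy
  have hy0 : 0 ≤ y := add_nonneg (mul_nonneg (by linarith) hx) (by positivity)
  have hyR : y ≤ (1 + o) * R := by
    have h1 : (1 - h * d) * x ≤ 1 * R :=
      mul_le_mul (by nlinarith [mul_nonneg hh.le hd]) hxR hx zero_le_one
    have h2 : h * o * z ≤ 1 * o * R := by gcongr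
    linarith
  have h1 := abs_one_sub_exp_div_sub_le (c := h * s) (y := y) (by positivity) hy0
  have h2 : (h * s) ^ 2 * y ^ 3 / 6 ≤ s ^ 2 * ((1 + o) * R) ^ 3 / 6 * h ^ 2 := by
    have : y ^ 3 ≤ ((1 + o) * R) ^ 3 := by gcongr
    calc (h * s) ^ 2 * y ^ 3 / 6 = s ^ 2 * y ^ 3 / 6 * h ^ 2 := by ring
      _ ≤ _ := by gcongr
  -- The linear part moves the coordinate by `O(h)` only, so replacing `y²` by `x²` in a term
  -- carrying a factor `h` costs `O(h²)`.
  have h3 : |y - x| ≤ h * ((d + o) * R) := by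
    have : y - x = h * (o * z - d * x) := by rw [hy]; ring
    rw [this, abs_mul, abs_of_pos hh]
    gcongr
    have := mul_le_mul_of_nonneg_left hzR ho
    have := mul_le_mul_of_nonneg_left hxR hd
    have := mul_nonneg ho hz
    have := mul_nonneg hd hx
    have := mul_nonneg ho hR
    have := mul_nonneg hd hR
    rw [abs_le]
    constructor <;> linarith
  have h4 : |(y - h * s / 2 * y ^ 2) - (x - h * (d * x - o * z + s / 2 * x ^ 2))| ≤
      s / 2 * ((d + o) * (2 + o)) * R ^ 2 * h ^ 2 := by
    have h5 : (y - h * s / 2 * y ^ 2) - (x - h * (d * x - o * z + s / 2 * x ^ 2)) =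
        -(h * s / 2 * (y + x) * (y - x)) := by
      have : y - (x - h * (d * x - o * z)) = 0 := by rw [hy]; ring
      linear_combination this
    rw [h5, abs_neg, abs_mul, abs_of_nonneg (by positivity)]
    calc h * s / 2 * (y + x) * |y - x|
        ≤ h * s / 2 * ((1 + o) * R + R) * (h * ((d + o) * R)) := by gcongr
      _ = _ := by ring
  calc _ ≤ _ := abs_sub_le _ (y - h * s / 2 * y ^ 2) _
    _ ≤ (h * s) ^ 2 * y ^ 3 / 6 + s / 2 * ((d + o) * (2 + o)) * R ^ 2 * h ^ 2 :=
        add_le_add h1 h4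
    _ ≤ _ := by linarith

variable (θ : Params)

/-- One step of a positivity preserving Euler scheme for `∂v/∂t = -φ(v)`, each step being the
cumulant map of a branching kernel. -/
noncomputable def Params.step (h : ℝ) : State → State :=
  -- The linear factor is the explicit Euler step for `-B`. Atoms of size `h σᵢ²` give Poisson
  -- sampling the variance `h σᵢ² xᵢ` of a Feller diffusion over time `h`. The truncations are
  -- harmless once `h * b₁₁ ≤ 1` and `h * b₂₂ ≤ 1`.
  poissonMap ![(h * θ.σ₁ ^ 2).toNNReal, (h * θ.σ₂ ^ 2).toNNReal] ∘
    linMap ![![(1 - h * θ.b₁₁).toNNReal, (h * θ.b₁₂).toNNReal],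
      ![(h * θ.b₂₁).toNNReal, (1 - h * θ.b₂₂).toNNReal]]

lemma Params.isBranching_step (h : ℝ) : IsBranching (θ.step h) :=
  (isBranching_poissonMap _).comp (isBranching_linMap _)

variable {θ} {h : ℝ}

lemma Params.coe_step_zero (hh : 0 < h) (h₁ : h * θ.b₁₁ ≤ 1) (l : State) :
    (θ.step h l 0 : ℝ) = (1 - Real.exp (-(h * θ.σ₁ ^ 2 *
      ((1 - h * θ.b₁₁) * l 0 + h * θ.b₁₂ * l 1)))) / (h * θ.σ₁ ^ 2) := by
  have e1 : 0 ≤ h * θ.σ₁ ^ 2 := by positivity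
  have e2 : 0 ≤ 1 - h * θ.b₁₁ := by linarith
  have e3 : 0 ≤ h * θ.b₁₂ := mul_nonneg hh.le θ.b₁₂_nonneg
  simp [step, coe_poissonMap, linMap, e1, e2, e3]

lemma Params.coe_step_one (hh : 0 < h) (h₂ : h * θ.b₂₂ ≤ 1) (l : State) :
    (θ.step h l 1 : ℝ) = (1 - Real.exp (-(h * θ.σ₂ ^ 2 *
      ((1 - h * θ.b₂₂) * l 1 + h * θ.b₂₁ * l 0)))) / (h * θ.σ₂ ^ 2) := by
  have e1 : 0 ≤ h * θ.σ₂ ^ 2 := by positivity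
  have e2 : 0 ≤ 1 - h * θ.b₂₂ := by linarith
  have e3 : 0 ≤ h * θ.b₂₁ := mul_nonneg hh.le θ.b₂₁_nonneg
  simp [step, coe_poissonMap, linMap, e1, e2, e3, add_comm]

lemma Params.step_apply_zero (h : ℝ) : θ.step h 0 = 0 := by
  ext i
  simp [step, coe_poissonMap, linMap]

/-- In the sup metric the constant is a bound for the row sums of the linear part. It serves twice:
to propagate the error of the scheme, and to keep its iterates near `0` for tightness. -/
lemma Params.lipschitzWith_step (hh : 0 < h) (h₁ : h * θ.b₁₁ ≤ 1) (h₂ : h * θ.b₂₂ ≤ 1) :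
    LipschitzWith (Real.toNNReal (1 + h * (θ.b₁₂ + θ.b₂₁))) (θ.step h) := by
  have p₁ := θ.b₁₁_pos
  have p₂ := θ.b₂₂_pos
  have n₁ := θ.b₁₂_nonneg
  have n₂ := θ.b₂₁_nonneg
  have s₁ := θ.σ₁_pos
  have s₂ := θ.σ₂_pos
  refine LipschitzWith.of_dist_le_mul fun l k => ?_
  rw [Real.coe_toNNReal _ (by positivity)]
  have hlin : ∀ {d o x x' z z' : ℝ}, 0 ≤ d → 0 ≤ o → h * d ≤ 1 → |x - x'| ≤ dist l k →
      |z - z'| ≤ dist l k → o ≤ θ.b₁₂ + θ.b₂₁ →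
      |((1 - h * d) * x + h * o * z) - ((1 - h * d) * x' + h * o * z')| ≤
        (1 + h * (θ.b₁₂ + θ.b₂₁)) * dist l k := by
    intro d o x x' z z' hd ho hhd hx hz hob
    have e : ((1 - h * d) * x + h * o * z) - ((1 - h * d) * x' + h * o * z') =
        (1 - h * d) * (x - x') + h * o * (z - z') := by ring
    rw [e]
    calc _ ≤ |(1 - h * d) * (x - x')| + |h * o * (z - z')| := abs_add_le _ _
      _ = (1 - h * d) * |x - x'| + h * o * |z - z'| := by
        rw [abs_mul, abs_mul, abs_of_nonneg (by linarith : 0 ≤ 1 - h * d),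
          abs_of_nonneg (by positivity : 0 ≤ h * o)]
      _ ≤ 1 * dist l k + h * (θ.b₁₂ + θ.b₂₁) * dist l k := by
        have : 1 - h * d ≤ 1 := by linarith [mul_nonneg hh.le hd]
        gcongr
      _ = _ := by ring
  have hcoord : ∀ i, |(l i : ℝ) - k i| ≤ dist l k := fun i => dist_le_pi_dist l k i
  have hL0 : ∀ m : State, 0 ≤ (1 - h * θ.b₁₁) * m 0 + h * θ.b₁₂ * m 1 := fun m =>
    add_nonneg (mul_nonneg (by linarith) (m 0).2) (by positivity)
  have hL1 : ∀ m : State, 0 ≤ (1 - h * θ.b₂₂) * m 1 + h * θ.b₂₁ * m 0 := fun m =>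
    add_nonneg (mul_nonneg (by linarith) (m 1).2) (by positivity)
  refine (dist_pi_le_iff (by positivity)).2 fun i => ?_
  rw [NNReal.dist_eq]
  fin_cases i
  · simp only [Fin.zero_eta]
    rw [coe_step_zero hh h₁, coe_step_zero hh h₁]
    exact (abs_one_sub_exp_div_sub_le_abs (by positivity) (hL0 l) (hL0 k)).trans
      (hlin p₁.le n₁ h₁ (hcoord 0) (hcoord 1) (by linarith))
  · simp only [Fin.mk_one]
    rw [coe_step_one hh h₂, coe_step_one hh h₂]
    exact (abs_one_sub_exp_div_sub_le_abs (by positivity) (hL1 l) (hL1 k)).trans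
      (hlin p₂.le n₂ h₂ (hcoord 1) (hcoord 0) (by linarith))

/-- The Euler step is consistent of order two, uniformly on bounded sets. -/
lemma Params.exists_abs_step_sub_le (θ : Params) (R : ℝ) :
    ∃ K, ∀ h, 0 < h → h ≤ 1 → h * θ.b₁₁ ≤ 1 → h * θ.b₂₂ ≤ 1 → ∀ l : State, (∀ i, (l i : ℝ) ≤ R) →
      ∀ i, |(θ.step h l i : ℝ) - (l i - h * θ.φ (fun j => (l j : ℝ)) i)| ≤ K * h ^ 2 := by
  set K₁ := (θ.σ₁ ^ 2 / 2 * ((θ.b₁₁ + θ.b₁₂) * (2 + θ.b₁₂)) * R ^ 2 +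
    (θ.σ₁ ^ 2) ^ 2 * ((1 + θ.b₁₂) * R) ^ 3 / 6)
  set K₂ := (θ.σ₂ ^ 2 / 2 * ((θ.b₂₂ + θ.b₂₁) * (2 + θ.b₂₁)) * R ^ 2 +
    (θ.σ₂ ^ 2) ^ 2 * ((1 + θ.b₂₁) * R) ^ 3 / 6)
  refine ⟨max K₁ K₂, fun h hh hh1 h₁ h₂ l hl i => ?_⟩
  fin_cases i
  · simp only [Fin.zero_eta]
    rw [coe_step_zero hh h₁]
    have := abs_step_sub_le hh hh1 (pow_pos θ.σ₁_pos 2) θ.b₁₁_pos.le θ.b₁₂_nonneg h₁ (l 0).2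
      (l 1).2 (hl 0) (hl 1)
    refine this.trans (mul_le_mul_of_nonneg_right (le_max_left _ _) (sq_nonneg h))
  · simp only [Fin.mk_one]
    rw [coe_step_one hh h₂]
    have := abs_step_sub_le hh hh1 (pow_pos θ.σ₂_pos 2) θ.b₂₂_pos.le θ.b₂₁_nonneg h₂ (l 1).2
      (l 0).2 (hl 1) (hl 0)
    have e : θ.φ (fun j => (l j : ℝ)) 1 =
        θ.b₂₂ * l 1 - θ.b₂₁ * l 0 + θ.σ₂ ^ 2 / 2 * (l 1 : ℝ) ^ 2 := by
      simp [φ]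
      ring
    rw [e]
    exact this.trans (mul_le_mul_of_nonneg_right (le_max_right _ _) (sq_nonneg h))

/-- The branching mechanism is bounded and Lipschitz on bounded sets. -/
lemma Params.exists_norm_φ_le (θ : Params) (R : ℝ) :
    ∃ K, 0 ≤ K ∧ ∀ a b : Fin 2 → ℝ, ‖a‖ ≤ R → ‖b‖ ≤ R →
      ‖θ.φ a‖ ≤ K ∧ ‖θ.φ a - θ.φ b‖ ≤ K * ‖a - b‖ := by
  have hsmooth : ContDiff ℝ 1 θ.φ := by
    rw [contDiff_pi]
    intro i
    fin_cases i <;>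
      simp only [φ, Fin.zero_eta, Fin.mk_one, Matrix.cons_val_zero, Matrix.cons_val_one] <;>
      fun_prop
  obtain ⟨C, hC⟩ := (isCompact_closedBall (0 : Fin 2 → ℝ) R).exists_bound_of_continuousOn
    hsmooth.continuous.continuousOn
  obtain ⟨D, hD⟩ := (isCompact_closedBall (0 : Fin 2 → ℝ) R).exists_bound_of_continuousOn
    (hsmooth.continuous_fderiv one_ne_zero).continuousOn
  refine ⟨max (max C D) 0, le_max_right _ _, fun a b ha hb => ?_⟩
  have ha' : a ∈ Metric.closedBall (0 : Fin 2 → ℝ) R := by simpa using ha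
  have hb' : b ∈ Metric.closedBall (0 : Fin 2 → ℝ) R := by simpa using hb
  refine ⟨(hC a ha').trans ((le_max_left _ _).trans (le_max_left _ _)), ?_⟩
  exact (convex_closedBall _ _).norm_image_sub_le_of_norm_fderiv_le
    (fun x _ => hsmooth.differentiable one_ne_zero x)
    (fun x hx => (hD x hx).trans ((le_max_right _ _).trans (le_max_left _ _))) hb' ha'

end Euler

/-! ### Taylor estimate for the cumulant flow. -/

section Flow

variable {θ : Params} {v : ℝ → State → Fin 2 → ℝ}

lemma Params.IsCumulantFlow.exists_norm_le (hv : θ.IsCumulantFlow v) (l : State) (t : ℝ) :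
    ∃ R, ∀ s ∈ Set.Icc 0 t, ‖v s l‖ ≤ R :=
  isCompact_Icc.exists_bound_of_continuousOn fun s hs =>
    (hv.ode l s hs.1).continuousWithinAt.mono Set.Icc_subset_Ici_self

/-- Second order Taylor estimate for the cumulant flow on a bounded time interval. -/
lemma Params.IsCumulantFlow.exists_norm_sub_le (hv : θ.IsCumulantFlow v) (l : State) (t : ℝ) :
    ∃ K, ∀ s h, 0 ≤ s → 0 ≤ h → s + h ≤ t →
      ‖v (s + h) l - (v s l - h • θ.φ (v s l))‖ ≤ K * h ^ 2 := by
  obtain ⟨R, hR⟩ := hv.exists_norm_le l t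
  obtain ⟨K, hK0, hK⟩ := θ.exists_norm_φ_le R
  refine ⟨K * K, fun s h hs hh hst => ?_⟩
  have hsub : Set.Icc s (s + h) ⊆ Set.Icc 0 t := Set.Icc_subset_Icc hs hst
  have hder : ∀ r ∈ Set.Icc s (s + h),
      HasDerivWithinAt (fun r => v r l) (-θ.φ (v r l)) (Set.Icc s (s + h)) r := fun r hr =>
    (hv.ode l r (hsub hr).1).mono (hsub.trans Set.Icc_subset_Ici_self)
  have hs' : s ∈ Set.Icc s (s + h) := ⟨le_rfl, by linarith⟩
  have hsh : s + h ∈ Set.Icc s (s + h) := ⟨by linarith, le_rfl⟩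
  have h1 : ∀ r ∈ Set.Icc s (s + h), ‖v r l - v s l‖ ≤ K * h := fun r hr => by
    have := Convex.norm_image_sub_le_of_norm_hasDerivWithin_le hder
      (fun x hx => by
        rw [norm_neg]
        exact (hK _ (v s l) (hR x (hsub hx)) (hR s (hsub hs'))).1) (convex_Icc _ _) hs' hr
    refine this.trans (mul_le_mul_of_nonneg_left ?_ hK0)
    rw [Real.norm_of_nonneg (sub_nonneg.2 hr.1)]
    linarith [hr.2]
  -- After subtracting the tangent line at `s`, the derivative is `φ(v_s) - φ(v_r)`, which is `O(h)`
  -- by the Lipschitz bound on `φ` and `h1`.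
  have hder2 : ∀ r ∈ Set.Icc s (s + h), HasDerivWithinAt
      (fun r => v r l + (r - s) • θ.φ (v s l)) (-θ.φ (v r l) + (1 : ℝ) • θ.φ (v s l))
      (Set.Icc s (s + h)) r := fun r hr =>
    (hder r hr).add ((((hasDerivAt_id r).sub_const s).smul_const _).hasDerivWithinAt)
  have := Convex.norm_image_sub_le_of_norm_hasDerivWithin_le (C := K * (K * h)) hder2
    (fun x hx => by
      have e : -θ.φ (v x l) + (1 : ℝ) • θ.φ (v s l) = -(θ.φ (v x l) - θ.φ (v s l)) := by
        rw [one_smul]; abel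
      rw [e, norm_neg]
      exact ((hK _ _ (hR x (hsub hx)) (hR s (hsub hs'))).2).trans
        (mul_le_mul_of_nonneg_left (h1 x hx) hK0)) (convex_Icc _ _) hs' hsh
  have e : v (s + h) l - (v s l - h • θ.φ (v s l)) =
      v (s + h) l + (s + h - s) • θ.φ (v s l) - (v s l + (s - s) • θ.φ (v s l)) := by
    simp only [add_sub_cancel_left, sub_self, zero_smul, add_zero]
    abel
  rw [e]
  refine this.trans (le_of_eq ?_)
  rw [add_sub_cancel_left, Real.norm_of_nonneg hh]
  ring

end Flow

/-! ### Construction of the branching part. -/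

section Existence

variable {θ : Params} {v : ℝ → State → Fin 2 → ℝ}

/-- Convergence of the Euler scheme to the cumulant flow. -/
lemma Params.IsCumulantFlow.exists_dist_iterate_step_le (hv : θ.IsCumulantFlow v) (l : State)
    (t : ℝ) : ∃ K, ∀ h, 0 < h → h ≤ 1 → h * θ.b₁₁ ≤ 1 → h * θ.b₂₂ ≤ 1 → ∀ n : ℕ, n * h ≤ t →
      dist ((θ.step h)^[n] l) (fun i => (v (n * h) l i).toNNReal) ≤
        n * (K * h ^ 2) * (1 + h * (θ.b₁₂ + θ.b₂₁)) ^ n := by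
  obtain ⟨R, hR⟩ := hv.exists_norm_le l t
  obtain ⟨K₁, hK₁⟩ := θ.exists_abs_step_sub_le R
  obtain ⟨K₂, hK₂⟩ := hv.exists_norm_sub_le l t
  refine ⟨|K₁| + |K₂|, fun h hh hh1 h₁ h₂ n => ?_⟩
  set ρ := 1 + h * (θ.b₁₂ + θ.b₂₁) with hρ
  have hρ1 : 1 ≤ ρ := by
    have := mul_nonneg hh.le (add_nonneg θ.b₁₂_nonneg θ.b₂₁_nonneg)
    linarith
  have hKh : 0 ≤ (|K₁| + |K₂|) * h ^ 2 := by positivity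
  induction n with
  | zero =>
    intro _
    have : (fun i => (v ((0 : ℕ) * h) l i).toNNReal) = l := by
      ext i
      simp [hv.initial]
    rw [this]
    simp
  | succ n ih =>
    intro hn
    have hnh : 0 ≤ n * h := by positivity
    have hn' : n * h + h ≤ t := by push_cast at hn; linarith
    have ih := ih (by linarith)
    set w : State := fun i => (v (n * h) l i).toNNReal with hw
    have hwv : (fun i => (w i : ℝ)) = v (n * h) l := by
      ext i
      exact Real.coe_toNNReal _ (hv.nonneg l _ hnh i)
    have hstep : dist (θ.step h w) (fun i => (v ((n + 1 : ℕ) * h) l i).toNNReal) ≤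
        (|K₁| + |K₂|) * h ^ 2 := by
      refine (dist_pi_le_iff hKh).2 fun i => ?_
      have e : ((n + 1 : ℕ) : ℝ) * h = n * h + h := by push_cast; ring
      rw [e, NNReal.dist_eq, Real.coe_toNNReal _ (hv.nonneg l _ (by linarith) i)]
      have hwR : ∀ i, (w i : ℝ) ≤ R := fun i => by
        rw [congrFun hwv i]
        exact (le_abs_self _).trans ((norm_le_pi_norm (v (n * h) l) i).trans
          (hR _ ⟨hnh, by linarith⟩))
      have a1 := hK₁ h hh hh1 h₁ h₂ w hwR i
      have a2 := (norm_le_pi_norm _ i).trans (hK₂ (n * h) h hnh hh.le hn')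
      rw [hwv, congrFun hwv i] at a1
      simp only [Pi.sub_apply, Pi.smul_apply, smul_eq_mul, Real.norm_eq_abs] at a2
      rw [abs_sub_comm] at a2
      have a3 := mul_le_mul_of_nonneg_right (le_abs_self K₁) (sq_nonneg h)
      have a4 := mul_le_mul_of_nonneg_right (le_abs_self K₂) (sq_nonneg h)
      refine (abs_sub_le _ (v (n * h) l i - h * θ.φ (v (n * h) l) i) _).trans ?_
      linarith
    have hlip := (Params.lipschitzWith_step hh h₁ h₂).dist_le_mul ((θ.step h)^[n] l) w
    rw [Real.coe_toNNReal _ (by linarith)] at hlip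
    rw [Function.iterate_succ_apply']
    -- Discrete Gronwall: the old error grows by `ρ` and one local error is added, which is then
    -- inflated by `ρ ^ (n + 1) ≥ 1` to match the shape of the bound.
    calc _ ≤ _ := dist_triangle _ (θ.step h w) _
      _ ≤ ρ * (n * ((|K₁| + |K₂|) * h ^ 2) * ρ ^ n) + (|K₁| + |K₂|) * h ^ 2 :=
        add_le_add (hlip.trans (mul_le_mul_of_nonneg_left ih (by linarith))) hstep
      _ ≤ ρ * (n * ((|K₁| + |K₂|) * h ^ 2) * ρ ^ n) + (|K₁| + |K₂|) * h ^ 2 * ρ ^ (n + 1) :=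
        add_le_add le_rfl (le_mul_of_one_le_right hKh (one_le_pow₀ hρ1))
      _ = _ := by push_cast; ring

/-- The branching part: for every `x` and `t > 0` there is a probability measure with Laplace
transform `e^{-⟨x, v_t(l)⟩}`. -/
lemma Params.IsCumulantFlow.exists_measure (hv : θ.IsCumulantFlow v) (x : State) {t : ℝ}
    (ht : 0 < t) : ∃ ν : Measure State, IsProbabilityMeasure ν ∧
      ∀ l, ∫ y, expPairing l y ∂ν = Real.exp (-pairing x (v t l)) := by
  set b := θ.b₁₂ + θ.b₂₁ with hb
  have hb0 : 0 ≤ b := add_nonneg θ.b₁₂_nonneg θ.b₂₁_nonneg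
  have p₁ := θ.b₁₁_pos
  have p₂ := θ.b₂₂_pos
  -- Taking at least `N` steps makes `h n * (1 + b₁₁ + b₂₂) ≤ 1`, which contains all three smallness
  -- conditions on the step size.
  obtain ⟨N, hN⟩ := exists_nat_ge (t * (1 + θ.b₁₁ + θ.b₂₂))
  set m : ℕ → ℕ := fun n => n + 1 + N
  set h : ℕ → ℝ := fun n => t / m n
  have hm : ∀ n, (0 : ℝ) < m n := fun n => by simp only [m]; positivity
  have hh : ∀ n, 0 < h n := fun n => div_pos ht (hm n)
  have hmh : ∀ n, m n * h n = t := fun n => mul_div_cancel₀ _ (hm n).ne'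
  have hsmall : ∀ n, h n * (1 + θ.b₁₁ + θ.b₂₂) ≤ 1 := fun n => by
    rw [div_mul_eq_mul_div, div_le_one (hm n)]
    refine hN.trans ?_
    simp only [m]
    push_cast
    linarith [(n.cast_nonneg : (0 : ℝ) ≤ n)]
  have hb₁ : ∀ n, 0 ≤ h n * θ.b₁₁ := fun n => (mul_pos (hh n) p₁).le
  have hb₂ : ∀ n, 0 ≤ h n * θ.b₂₂ := fun n => (mul_pos (hh n) p₂).le
  have hh1 : ∀ n, h n ≤ 1 := fun n => by linarith [hsmall n, hb₁ n, hb₂ n]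
  have h₁ : ∀ n, h n * θ.b₁₁ ≤ 1 := fun n => by linarith [hsmall n, hh n, hb₂ n]
  have h₂ : ∀ n, h n * θ.b₂₂ ≤ 1 := fun n => by linarith [hsmall n, hh n, hb₁ n]
  have hpow : ∀ n, (1 + h n * b) ^ m n ≤ Real.exp (t * b) := fun n => by
    have h1 : 1 + h n * b ≤ Real.exp (h n * b) := by
      linarith [Real.add_one_le_exp (h n * b)]
    refine (pow_le_pow_left₀ (by have := hh n; positivity) h1 _).trans (le_of_eq ?_)
    rw [← Real.exp_nat_mul, ← mul_assoc, hmh]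
  set ψ : ℕ → State → State := fun n => (θ.step (h n))^[m n]
  have hψ : ∀ n, IsBranching (ψ n) := fun n => (θ.isBranching_step _).iterate _
  choose K hK hKψ using hψ
  have hh0 : Tendsto h atTop (𝓝 0) := by
    refine tendsto_const_nhds.div_atTop ?_
    simp only [m]
    push_cast
    exact tendsto_atTop_add_const_right _ _
      (tendsto_atTop_add_const_right _ _ tendsto_natCast_atTop_atTop)
  have hconv : ∀ l i, Tendsto (fun n => (ψ n l i : ℝ)) atTop (𝓝 (v t l i)) := by
    intro l i
    obtain ⟨K, hK⟩ := hv.exists_dist_iterate_step_le l t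
    rw [tendsto_iff_dist_tendsto_zero]
    refine squeeze_zero (fun _ => dist_nonneg) (g := fun n => t * |K| * Real.exp (t * b) * h n)
      (fun n => ?_) (by simpa using hh0.const_mul (t * |K| * Real.exp (t * b)))
    have h3 := (dist_le_pi_dist _ _ i).trans
      (hK (h n) (hh n) (hh1 n) (h₁ n) (h₂ n) (m n) (hmh n).le)
    rw [hmh, NNReal.dist_eq, Real.coe_toNNReal _ (hv.nonneg l t ht.le i)] at h3
    refine h3.trans ?_
    have h4 : (m n : ℝ) * (K * h n ^ 2) ≤ t * |K| * h n := by
      calc (m n : ℝ) * (K * h n ^ 2) = (m n * h n) * h n * K := by ring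
        _ = t * h n * K := by rw [hmh]
        _ ≤ t * h n * |K| :=
          mul_le_mul_of_nonneg_left (le_abs_self K) (mul_pos ht (hh n)).le
        _ = _ := by ring
    calc _ ≤ t * |K| * h n * (1 + h n * b) ^ m n :=
          mul_le_mul_of_nonneg_right h4 (by have := hh n; positivity)
      _ ≤ t * |K| * h n * Real.exp (t * b) :=
          mul_le_mul_of_nonneg_left (hpow n) (by have := hh n; positivity)
      _ = _ := by ring
  refine exists_measure_of_tendsto_laplace (fun n => K n x) _ (fun l => ?_) fun ε hε => ?_
  · simp_rw [hKψ, expPairing_apply, pairing]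
    exact (Real.continuous_exp.tendsto _).comp
      ((((hconv l 0).const_mul _).add ((hconv l 1).const_mul _)).neg)
  -- Tightness uniform in `n`: each step fixes `0`, so the Lipschitz bound for the iterates gives `ψ
  -- n δ ≤ exp (t b) δ` coordinatewise. The exponent is then at most `c δ ≤ ε`; dividing by `c + 1`
  -- allows for `c = 0`.
  · set c : ℝ := ((x 0 : ℝ) + x 1) * Real.exp (t * b) with hc
    have hc0 : 0 ≤ c := by positivity
    refine ⟨(ε / (c + 1)).toNNReal, Real.toNNReal_pos.2 (by positivity), fun n => ?_⟩
    set δ := (ε / (c + 1)).toNNReal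
    have hδ : (δ : ℝ) = ε / (c + 1) := Real.coe_toNNReal _ (by positivity)
    have hbound : ∀ i, (ψ n (fun _ => δ) i : ℝ) ≤ Real.exp (t * b) * δ := fun i => by
      have h3 := ((Params.lipschitzWith_step (hh n) (h₁ n) (h₂ n)).iterate (m n)).dist_le_mul
        (fun _ => δ) 0
      rw [Function.iterate_fixed (Params.step_apply_zero _)] at h3
      have h4 := (dist_le_pi_dist _ _ i).trans h3
      rw [NNReal.dist_eq, NNReal.coe_pow, Real.coe_toNNReal _ (by have := hh n; positivity)] at h4
      have h5 : dist (fun _ => δ) (0 : State) ≤ δ := by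
        refine (dist_pi_le_iff δ.2).2 fun i => ?_
        simp [NNReal.dist_eq]
      simp only [Pi.zero_apply, NNReal.coe_zero, sub_zero] at h4
      refine (le_abs_self _).trans (h4.trans ?_)
      exact mul_le_mul (hpow n) h5 dist_nonneg (Real.exp_pos _).le
    rw [hKψ, expPairing_apply]
    have h6 : pairing x (fun i => (ψ n (fun _ => δ) i : ℝ)) ≤ c * δ := by
      have := mul_le_mul_of_nonneg_left (hbound 0) (x 0).2
      have := mul_le_mul_of_nonneg_left (hbound 1) (x 1).2
      simp only [pairing, hc]
      simp only [NNReal.val_eq_coe] at *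
      linarith
    have h7 : c * δ ≤ ε := by
      rw [hδ, ← mul_div_assoc, div_le_iff₀ (by positivity)]
      nlinarith
    linarith [Real.add_one_le_exp (-pairing x (fun i => (ψ n (fun _ => δ) i : ℝ)))]

end Existence

/-! ### Subcriticality and coming down from infinity. -/

section Decay

variable {θ : Params} {v : ℝ → State → Fin 2 → ℝ}

/-- The discriminant `(b₁₁ - b₂₂)² + 4 b₁₂ b₂₁` is nonnegative, so both eigenvalues are real. If
`det B ≤ 0`, the smaller one is nonpositive. -/
lemma Params.det_pos_of_eigenvalue_pos (θ : Params)
    (hB : ∀ μ : ℝ, Module.End.HasEigenvalue (Matrix.toLin' θ.B) μ → 0 < μ) :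
    θ.b₁₂ * θ.b₂₁ < θ.b₁₁ * θ.b₂₂ := by
  by_contra! hdet
  have n₁ := θ.b₁₂_nonneg
  have n₂ := θ.b₂₁_nonneg
  set D := (θ.b₁₁ - θ.b₂₂) ^ 2 + 4 * (θ.b₁₂ * θ.b₂₁) with hD
  have hD0 : 0 ≤ D := by positivity
  set μ := (θ.b₁₁ + θ.b₂₂ - √D) / 2 with hμ
  have hroot : (θ.b₁₁ - μ) * (θ.b₂₂ - μ) - θ.b₁₂ * θ.b₂₁ = 0 := by
    have := Real.sq_sqrt hD0
    rw [hμ]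
    nlinarith
  have hμ0 : μ ≤ 0 := by
    have : θ.b₁₁ + θ.b₂₂ ≤ √D := Real.le_sqrt_of_sq_le (by rw [hD]; nlinarith)
    rw [hμ]
    linarith
  have hdet0 : (θ.B - μ • (1 : Matrix (Fin 2) (Fin 2) ℝ)).det = 0 := by
    simp [B, Matrix.det_fin_two]
    linarith
  obtain ⟨w, hw0, hw⟩ := Matrix.exists_mulVec_eq_zero_iff.2 hdet0
  refine absurd (hB μ ?_) (not_lt.2 hμ0)
  refine Module.End.hasEigenvalue_of_hasEigenvector (x := w)
    ⟨Module.End.mem_eigenspace_iff.2 ?_, hw0⟩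
  rw [Matrix.sub_mulVec, Matrix.smul_mulVec, Matrix.one_mulVec, sub_eq_zero] at hw
  rw [Matrix.toLin'_apply, hw]

/-- In the subcritical case the cumulant flow comes down from infinity: it is bounded at time `t`
by a multiple of `1 / t`, whatever its initial value. -/
lemma Params.IsCumulantFlow.exists_le_div (hv : θ.IsCumulantFlow v)
    (hdet : θ.b₁₂ * θ.b₂₁ < θ.b₁₁ * θ.b₂₂) :
    ∃ C, 0 ≤ C ∧ ∀ (l : State) (t : ℝ), 0 < t → ∀ i, v t l i ≤ C / t := by
  have n₁ := θ.b₁₂_nonneg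
  have n₂ := θ.b₂₁_nonneg
  have q₁ := θ.b₁₁_pos
  have q₂ := θ.b₂₂_pos
  have r₁ := θ.σ₁_pos
  have r₂ := θ.σ₂_pos
  -- The positive row vector `p` satisfies `p B = det B • (1, 1)`, so the linear drift of `p₁ v₁ +
  -- p₂ v₂` is `-det B (v₁ + v₂) ≤ 0`.
  set p₁ := θ.b₂₂ + θ.b₂₁ with hp₁
  set p₂ := θ.b₁₁ + θ.b₁₂ with hp₂
  have hp₁0 : 0 < p₁ := by positivity
  have hp₂0 : 0 < p₂ := by positivity
  set s₁ := θ.σ₁ ^ 2 / 2 with hs₁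
  set s₂ := θ.σ₂ ^ 2 / 2 with hs₂
  -- The largest value for which `2 ε pᵢ ≤ sᵢ` in both coordinates. With `(a + b)² ≤ 2a² + 2b²`, the
  -- quadratic terms then dominate `ε q²`.
  set ε := min (s₁ / p₁) (s₂ / p₂) / 2 with hε
  have hε0 : 0 < ε := by positivity
  have hε₁ : ε * p₁ * 2 ≤ s₁ := by
    have : ε * 2 ≤ s₁ / p₁ := by rw [hε, div_mul_cancel₀ _ two_ne_zero]; exact min_le_left _ _
    rw [le_div_iff₀ hp₁0] at this
    linarith
  have hε₂ : ε * p₂ * 2 ≤ s₂ := by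
    have : ε * 2 ≤ s₂ / p₂ := by rw [hε, div_mul_cancel₀ _ two_ne_zero]; exact min_le_right _ _
    rw [le_div_iff₀ hp₂0] at this
    linarith
  have key : ∀ (l : State) (t : ℝ), 0 < t → p₁ * v t l 0 + p₂ * v t l 1 ≤ 1 / (ε * t) := by
    intro l t ht
    set q : ℝ → ℝ := fun s => p₁ * v s l 0 + p₂ * v s l 1 with hq
    set q' : ℝ → ℝ := fun s => p₁ * (-θ.φ (v s l)) 0 + p₂ * (-θ.φ (v s l)) 1 with hq'
    have hcoord : ∀ s, 0 ≤ s → ∀ i,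
        HasDerivWithinAt (fun s => v s l i) ((-θ.φ (v s l)) i) (Set.Ici 0) s := fun s hs i =>
      hasDerivWithinAt_pi.1 (hv.ode l s hs) i
    have hder : ∀ s, 0 ≤ s → HasDerivWithinAt q (q' s) (Set.Ici 0) s := fun s hs =>
      ((hcoord s hs 0).const_mul p₁).add ((hcoord s hs 1).const_mul p₂)
    have hder' : ∀ s, 0 < s → HasDerivAt q (q' s) s := fun s hs =>
      (hder s hs.le).hasDerivAt (Ici_mem_nhds hs)
    have hcont : ContinuousOn q (Set.Ici 0) := fun s hs => (hder s hs).continuousWithinAt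
    have hq'le : ∀ s, 0 ≤ s → q' s ≤ -(ε * q s ^ 2) := by
      intro s hs
      have hx := hv.nonneg l s hs 0
      have hy := hv.nonneg l s hs 1
      set x := v s l 0
      set y := v s l 1
      have e : q' s = -((θ.b₁₁ * θ.b₂₂ - θ.b₁₂ * θ.b₂₁) * (x + y)) -
          (p₁ * s₁ * x ^ 2 + p₂ * s₂ * y ^ 2) := by
        simp only [hq', φ, Pi.neg_apply, Matrix.cons_val_zero, Matrix.cons_val_one]
        rw [hp₁, hp₂, hs₁, hs₂]
        ring
      have e1 : 0 ≤ (θ.b₁₁ * θ.b₂₂ - θ.b₁₂ * θ.b₂₁) * (x + y) :=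
        mul_nonneg (by linarith) (by linarith)
      have e2 : ε * p₁ * 2 * (p₁ * x ^ 2) ≤ s₁ * (p₁ * x ^ 2) :=
        mul_le_mul_of_nonneg_right hε₁ (by positivity)
      have e3 : ε * p₂ * 2 * (p₂ * y ^ 2) ≤ s₂ * (p₂ * y ^ 2) :=
        mul_le_mul_of_nonneg_right hε₂ (by positivity)
      have e4 : 0 ≤ ε * (p₁ * x - p₂ * y) ^ 2 := by positivity
      have e5 : ε * q s ^ 2 = ε * (p₁ * x + p₂ * y) ^ 2 := rfl
      rw [e, e5]
      linarith
    have hanti : AntitoneOn q (Set.Ici 0) := by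
      refine antitoneOn_of_deriv_nonpos (convex_Ici 0) hcont (fun s hs => ?_) fun s hs => ?_
      · rw [interior_Ici] at hs
        exact (hder' s hs).differentiableAt.differentiableWithinAt
      · rw [interior_Ici] at hs
        rw [(hder' s hs).deriv]
        have : 0 ≤ ε * q s ^ 2 := by positivity
        linarith [hq'le s (le_of_lt hs)]
    change q t ≤ _
    rcases le_or_gt (q t) 0 with h0 | hpos
    · exact h0.trans (by positivity)
    -- As `q` decreases, positivity at `t` gives positivity on all of `[0, t]`, so `1 / q` is
    -- available there.
    have hqpos : ∀ s ∈ Set.Icc 0 t, 0 < q s := fun s hs =>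
      hpos.trans_le (hanti hs.1 ht.le hs.2)
    -- Riccati comparison: `q' ≤ -ε q²` says `(1/q)' ≥ ε`. Hence `1 / q t ≥ ε t` whatever the value
    -- of `q 0`.
    have hmono : MonotoneOn (fun s => (q s)⁻¹ - ε * s) (Set.Icc 0 t) := by
      have hd : ∀ s ∈ Set.Ioo 0 t,
          HasDerivAt (fun s => (q s)⁻¹ - ε * s) (-q' s / q s ^ 2 - ε * 1) s := fun s hs =>
        ((hder' s hs.1).inv (hqpos s (Set.Ioo_subset_Icc_self hs)).ne').sub
          ((hasDerivAt_id s).const_mul ε)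
      refine monotoneOn_of_deriv_nonneg (convex_Icc 0 t) ?_ (fun s hs => ?_) fun s hs => ?_
      · exact ((hcont.mono Set.Icc_subset_Ici_self).inv₀ fun s hs => (hqpos s hs).ne').sub
          (by fun_prop)
      · rw [interior_Icc] at hs
        exact (hd s hs).differentiableAt.differentiableWithinAt
      · rw [interior_Icc] at hs
        rw [(hd s hs).deriv, mul_one, sub_nonneg,
          le_div_iff₀ (pow_pos (hqpos s (Set.Ioo_subset_Icc_self hs)) 2)]
        linarith [hq'le s hs.1.le]
    have h := hmono ⟨le_rfl, ht.le⟩ ⟨ht.le, le_rfl⟩ ht.le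
    simp only [mul_zero, sub_zero] at h
    have h1 : ε * t ≤ (q t)⁻¹ := by
      have := inv_pos.2 (hqpos 0 ⟨le_rfl, ht.le⟩)
      linarith
    rw [one_div]
    exact le_inv_of_le_inv₀ (by positivity) h1
  refine ⟨1 / (ε * p₁) + 1 / (ε * p₂), by positivity, fun l t ht i => ?_⟩
  have h := key l t ht
  have h0 := mul_nonneg hp₁0.le (hv.nonneg l t ht.le 0)
  have h1 := mul_nonneg hp₂0.le (hv.nonneg l t ht.le 1)
  rw [add_div]
  have g0 : (0 : ℝ) ≤ 1 / (ε * p₁) / t := by positivity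
  have g1 : (0 : ℝ) ≤ 1 / (ε * p₂) / t := by positivity
  fin_cases i
  · have : v t l 0 ≤ 1 / (ε * p₁) / t := by
      rw [div_div, mul_right_comm, ← div_div, le_div_iff₀ hp₁0]
      linarith
    simp only [Fin.zero_eta]
    linarith
  · have : v t l 1 ≤ 1 / (ε * p₂) / t := by
      rw [div_div, mul_right_comm, ← div_div, le_div_iff₀ hp₂0]
      linarith
    simp only [Fin.mk_one]
    linarith

end Decay

/-! ### Loss of memory in total variation. -/

section TotalVariation

variable {θ : Params} {Q : ℝ≥0 → Kernel State State}

/-- In the subcritical case the total variation distance of `Q_t(x, ·)` and `Q_t(0, ·)` is at most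
`1 - e^{-C (x₁ + x₂) / t}`. -/
lemma Params.IsTransitionSemigroup.exists_abs_lintegral_sub_le (hQ : θ.IsTransitionSemigroup Q)
    (hdet : θ.b₁₂ * θ.b₂₁ < θ.b₁₁ * θ.b₂₂) :
    ∃ C : ℝ, 0 ≤ C ∧ ∀ t : ℝ≥0, 0 < t → ∀ (x : State) (f : State → ENNReal), Measurable f →
      (∀ y, f y ≤ 1) → |(∫⁻ y, f y ∂(Q t x)).toReal - (∫⁻ y, f y ∂(Q t 0)).toReal| ≤
        1 - Real.exp (-(((x 0 : ℝ) + x 1) * (C / t))) := by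
  obtain ⟨v, hv, hL⟩ := hQ.laplace
  obtain ⟨C, hC0, hC⟩ := hv.exists_le_div hdet
  refine ⟨C, hC0, fun t ht x f hf hf1 => ?_⟩
  have := hQ.markov t
  have ht' : (0 : ℝ) < t := ht
  obtain ⟨ν, _, hν⟩ := hv.exists_measure x ht'
  -- The bound on `v t l` does not depend on `l`, so it survives `l = (n, n) → ∞`, where the
  -- transform tends to the mass at `0`.
  have hatom : Real.exp (-(((x 0 : ℝ) + x 1) * (C / t))) ≤ ν.real {0} := by
    refine ge_of_tendsto' (tendsto_integral_expPairing_atTop ν) fun n => ?_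
    rw [hν, Real.exp_le_exp, neg_le_neg_iff, pairing, add_mul]
    exact add_le_add (mul_le_mul_of_nonneg_left (hC _ t ht' 0) (x 0).2)
      (mul_le_mul_of_nonneg_left (hC _ t ht' 1) (x 1).2)
  -- The immigration factor of the transform does not depend on `x`, and is exactly the transform of
  -- `Q t 0`.
  have hconv : Q t x = ν ∗ Q t 0 := by
    refine ext_of_laplace fun l => ?_
    rw [integral_conv ((expPairing l).integrable _)]
    have hmul : ∀ y z, expPairing l (y + z) = expPairing l y * expPairing l z := fun y z => by
      simp only [expPairing_apply, ← Real.exp_add, pairing_add_left, neg_add]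
    simp_rw [hmul, integral_const_mul, integral_mul_const, hν, expPairing_apply, hL]
    rw [← Real.exp_add]
    congr 1
    simp only [pairing, Pi.zero_apply, NNReal.coe_zero]
    ring
  set g : State → ENNReal := fun y => ∫⁻ z, f (y + z) ∂(Q t 0) with hg
  have hg1 : ∀ y, g y ≤ 1 := fun y => by
    calc g y ≤ ∫⁻ _, 1 ∂(Q t 0) := lintegral_mono fun z => hf1 _
      _ = 1 := by simp
  have hgx : ∫⁻ y, f y ∂(Q t x) = ∫⁻ y, g y ∂ν := by
    rw [hconv, Measure.lintegral_conv hf]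
  have hg0 : ∫⁻ y, f y ∂(Q t 0) = g 0 := by simp [hg]
  -- On the atom the two integrals agree; elsewhere `0 ≤ g ≤ 1`, so they differ by at most the
  -- remaining mass `1 - ν {0}`.
  have hsplit : ∫⁻ y, g y ∂ν = g 0 * ν {0} + ∫⁻ y in {0}ᶜ, g y ∂ν := by
    rw [← lintegral_add_compl g (measurableSet_singleton (0 : State)), lintegral_singleton]
  have hrest : ∫⁻ y in ({0}ᶜ : Set State), g y ∂ν ≤ ν {0}ᶜ := by
    calc ∫⁻ y in ({0}ᶜ : Set State), g y ∂ν ≤ ∫⁻ _ in ({0}ᶜ : Set State), 1 ∂ν :=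
          lintegral_mono fun y => hg1 y
      _ = _ := by simp
  have hrest' : (∫⁻ y in ({0}ᶜ : Set State), g y ∂ν).toReal ≤ 1 - ν.real {0} := by
    rw [← probReal_compl_eq_one_sub (measurableSet_singleton _)]
    exact ENNReal.toReal_mono (measure_ne_top _ _) hrest
  have hne : ∫⁻ y in ({0}ᶜ : Set State), g y ∂ν ≠ ⊤ := ne_top_of_le_ne_top (measure_ne_top _ _) hrest
  have hg0ne : g 0 ≠ ⊤ := ne_top_of_le_ne_top ENNReal.one_ne_top (hg1 0)
  rw [hgx, hg0, hsplit, ENNReal.toReal_add (ENNReal.mul_ne_top hg0ne (measure_ne_top _ _)) hne,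
    ENNReal.toReal_mul]
  have hr0 : 0 ≤ (∫⁻ y in ({0}ᶜ : Set State), g y ∂ν).toReal := ENNReal.toReal_nonneg
  have hg0' : (g 0).toReal ≤ 1 := ENNReal.toReal_mono ENNReal.one_ne_top (hg1 0)
  have hg00 : 0 ≤ (g 0).toReal := ENNReal.toReal_nonneg
  have hν1 : ν.real {0} ≤ 1 := measureReal_le_one
  change |(g 0).toReal * ν.real {0} + _ - _| ≤ _
  rw [abs_le]
  constructor <;> nlinarith

end TotalVariation

end TwoTypeCBI

/-! ### The Markov property on path space. -/

namespace TwoTypeCBI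

variable {Ω : Type*} {Q : ℝ≥0 → Kernel State State} {X : ℝ≥0 → Ω → State}

lemma past_mono (X : ℝ≥0 → Ω → State) {s t : ℝ≥0} (hst : s ≤ t) : past X s ≤ past X t :=
  iSup₂_le fun r hr => le_iSup₂_of_le r (hr.trans hst) le_rfl

lemma measurable_past {s t : ℝ≥0} (hst : s ≤ t) : Measurable[past X t] (X s) :=
  measurable_iff_comap_le.2 (le_iSup₂_of_le s hst le_rfl)

/-- The σ-algebra on `Ω` generated by the whole process is generated by the intersection-stable
family of cylinder sets. -/
lemma generateFrom_cylinders (X : ℝ≥0 → Ω → State) :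
    ⨆ s, MeasurableSpace.comap (X s) inferInstance = MeasurableSpace.generateFrom
      (piiUnionInter (fun s => {A | MeasurableSet[MeasurableSpace.comap (X s) inferInstance] A})
        Set.univ) := by
  rw [generateFrom_piiUnionInter_measurableSet]
  simp

lemma comap_path (X : ℝ≥0 → Ω → State) :
    MeasurableSpace.comap (path X) inferInstance =
      ⨆ s, MeasurableSpace.comap (X s) inferInstance := by
  change MeasurableSpace.comap (path X) (⨆ _, _) = _
  rw [MeasurableSpace.comap_iSup]
  simp_rw [MeasurableSpace.comap_comp]
  rfl

lemma measurable_shift (t : ℝ≥0) : Measurable (shift t) :=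
  measurable_pi_lambda _ fun s => measurable_pi_apply (t + s)

/-- Every event of the future after `t` is of the form `{θ_t X ∈ A}`. -/
lemma exists_shift_of_measurableSet_future {t : ℝ≥0} {E : Set Ω}
    (hE : MeasurableSet[⨆ s : ℝ≥0, ⨆ _ : t ≤ s, MeasurableSpace.comap (X s) inferInstance] E) :
    ∃ A, MeasurableSet A ∧ E = {ω | shift t (path X ω) ∈ A} := by
  have hle : ⨆ s : ℝ≥0, ⨆ _ : t ≤ s, MeasurableSpace.comap (X s) inferInstance ≤
      MeasurableSpace.comap (fun ω => shift t (path X ω)) inferInstance := by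
    refine iSup₂_le fun s hs => ?_
    rintro _ ⟨B, hB, rfl⟩
    refine ⟨(fun w => w (s - t)) ⁻¹' B, measurable_pi_apply _ hB, ?_⟩
    ext ω
    simp [shift, path, add_tsub_cancel_of_le hs]
  obtain ⟨A, hA, rfl⟩ := hle E hE
  exact ⟨A, hA, rfl⟩

variable [mΩ : MeasurableSpace Ω] {P : Measure Ω}

namespace IsMarkovProcess

lemma past_le (hX : IsMarkovProcess P Q X) (s : ℝ≥0) : past X s ≤ mΩ :=
  iSup₂_le fun r _ => (hX.measurable r).comap_le

lemma measurable_path (hX : IsMarkovProcess P Q X) : Measurable (path X) :=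
  measurable_pi_lambda _ hX.measurable

variable [IsProbabilityMeasure P]

lemma measure_inter_preimage (hX : IsMarkovProcess P Q X) (hQ : ∀ t, IsMarkovKernel (Q t))
    (s t : ℝ≥0) {C : Set Ω} (hC : MeasurableSet[past X s] C) {A : Set State}
    (hA : MeasurableSet A) : P (C ∩ X (s + t) ⁻¹' A) = ∫⁻ ω in C, Q t (X s ω) A ∂P := by
  have hC' := hX.past_le s C hC
  have hA' := hX.measurable (s + t) hA
  have hm : Measurable fun ω => Q t (X s ω) A :=
    ((Q t).measurable_coe hA).comp (hX.measurable s)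
  have h1 := setIntegral_condExp (hX.past_le s)
    (((integrable_const (1 : ℝ)).indicator hA' : Integrable _ P)) hC
  rw [setIntegral_congr_ae hC' ((hX.transition s t A hA).mono fun ω hω _ => hω),
    integral_indicator hA', Measure.restrict_restrict hA'] at h1
  simp only [measureReal_def] at h1
  rw [integral_toReal hm.aemeasurable (ae_of_all _ fun ω => by
    have := hQ t
    exact measure_lt_top _ _)] at h1
  simp only [integral_const, smul_eq_mul, mul_one, measureReal_def,
    Measure.restrict_apply_univ] at h1
  have hfin : ∫⁻ ω in C, Q t (X s ω) A ∂P ≠ ⊤ := by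
    have := hQ t
    refine ne_top_of_le_ne_top (measure_ne_top P C) ?_
    calc _ ≤ ∫⁻ _ in C, 1 ∂P := lintegral_mono fun ω => prob_le_one
      _ = _ := by simp
  rw [Set.inter_comm]
  exact ((ENNReal.toReal_eq_toReal_iff' hfin (measure_ne_top _ _)).1 h1).symm

/-- Restricted to a past event, the law of `X (s + t)` is the law of `X s` transported by `Q t`.
Stating the Markov property as an equality of measures covers all measurable `f` at once. -/
lemma setLIntegral_comp (hX : IsMarkovProcess P Q X) (hQ : ∀ t, IsMarkovKernel (Q t))
    (s t : ℝ≥0) {C : Set Ω} (hC : MeasurableSet[past X s] C) {f : State → ENNReal}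
    (hf : Measurable f) :
    ∫⁻ ω in C, f (X (s + t) ω) ∂P = ∫⁻ ω in C, ∫⁻ y, f y ∂(Q t (X s ω)) ∂P := by
  have h : (P.restrict C).map (X (s + t)) = ((P.restrict C).map (X s)).bind (Q t) := by
    ext A hA
    rw [Measure.map_apply (hX.measurable _) hA, Measure.bind_apply hA (Q t).aemeasurable,
      lintegral_map ((Q t).measurable_coe hA) (hX.measurable s),
      Measure.restrict_apply (hX.measurable _ hA), Set.inter_comm,
      hX.measure_inter_preimage hQ s t hC hA]
  rw [← lintegral_map hf (hX.measurable _), h,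
    Measure.lintegral_bind (Q t).aemeasurable hf.aemeasurable,
    lintegral_map hf.lintegral_kernel (hX.measurable s)]

/-- The Markov property for finite-dimensional cylinder sets. -/
lemma exists_cylinder (hX : IsMarkovProcess P Q X) (hQ : ∀ t, IsMarkovKernel (Q t))
    (A : ℝ≥0 → Set State) (T : Finset ℝ≥0) : (∀ r ∈ T, MeasurableSet (A r)) →
    ∀ u : ℝ≥0, (∀ r ∈ T, u ≤ r) → ∃ h : State → ENNReal, Measurable h ∧ (∀ y, h y ≤ 1) ∧
      ∀ (s : ℝ≥0) (C : Set Ω), MeasurableSet[past X (s + u)] C →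
        P (C ∩ ⋂ r ∈ T, X (s + r) ⁻¹' A r) = ∫⁻ ω in C, h (X (s + u) ω) ∂P := by
  induction T using Finset.induction_on_min with
  | empty => exact fun _ u _ => ⟨fun _ => 1, measurable_const, fun _ => le_rfl, by simp⟩
  | insert a T haT ih =>
    intro hA u hu
    -- The earliest time `a` is peeled off: the later times give a function `k` of the state at `a`,
    -- and one transition from `u` to `a` applied to `k` cut off to `A a` gives the required
    -- function. Time homogeneity makes it independent of `s`.
    obtain ⟨k, hk, hk1, hkP⟩ := ih (fun r hr => hA r (Finset.mem_insert_of_mem hr)) a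
      fun r hr => (haT r hr).le
    have hAa := hA a (Finset.mem_insert_self _ _)
    have hua := hu a (Finset.mem_insert_self _ _)
    have hka : Measurable ((A a).indicator k) := hk.indicator hAa
    refine ⟨fun y => ∫⁻ z, (A a).indicator k z ∂(Q (a - u) y), hka.lintegral_kernel,
      fun y => ?_, fun s C hC => ?_⟩
    · have := hQ (a - u)
      calc _ ≤ ∫⁻ _, 1 ∂(Q (a - u) y) :=
            lintegral_mono fun z => (Set.indicator_le_self' (fun _ _ => zero_le) z).trans (hk1 z)
        _ = 1 := by simp
    · have hadd : s + a = s + u + (a - u) := by rw [add_assoc, add_tsub_cancel_of_le hua]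
      have hsub : past X (s + u) ≤ past X (s + a) := past_mono X (by gcongr)
      have hpre : MeasurableSet[past X (s + a)] (X (s + a) ⁻¹' A a) :=
        measurable_past le_rfl hAa
      have hCa : MeasurableSet[past X (s + a)] (C ∩ X (s + a) ⁻¹' A a) :=
        MeasurableSet.inter (hsub C hC) hpre
      rw [Finset.set_biInter_insert, ← Set.inter_assoc, hkP s _ hCa, Set.inter_comm C,
        ← Measure.restrict_restrict (hX.past_le _ _ hpre),
        ← lintegral_indicator (hX.past_le _ _ hpre)]
      rw [← hX.setLIntegral_comp hQ _ _ hC hka, ← hadd]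
      rfl

/-- The Markov property on path space: given the past up to `s`, the conditional probability of
`{θ_s X ∈ A}` is a function of `X_s`, and this function does not depend on `s`. -/
lemma exists_shift (hX : IsMarkovProcess P Q X) (hQ : ∀ t, IsMarkovKernel (Q t))
    {A : Set (ℝ≥0 → State)} (hA : MeasurableSet A) :
    ∃ h : State → ENNReal, Measurable h ∧ (∀ y, h y ≤ 1) ∧
      ∀ (s : ℝ≥0) (C : Set Ω), MeasurableSet[past X s] C →
        P (C ∩ {ω | shift s (path X ω) ∈ A}) = ∫⁻ ω in C, h (X s ω) ∂P := by
  have hpi := generateFrom_cylinders fun (s : ℝ≥0) (w : ℝ≥0 → State) => w s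
  have hmeas : ∀ {A : Set (ℝ≥0 → State)}, MeasurableSet A → ∀ s,
      MeasurableSet {ω | shift s (path X ω) ∈ A} := fun hA s =>
    ((measurable_shift s).comp hX.measurable_path) hA
  induction A, hA using MeasurableSpace.induction_on_inter (h_eq := hpi) with
  | h_inter => exact isPiSystem_piiUnionInter _ (fun s =>
      @MeasurableSpace.isPiSystem_measurableSet _ (MeasurableSpace.comap _ _)) _
  | empty => exact ⟨fun _ => 0, measurable_const, fun _ => zero_le, by simp⟩
  | basic A hA =>
    obtain ⟨T, -, f, hf, rfl⟩ := hA
    choose! B hB hBf using hf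
    obtain ⟨h, hh, hh1, hP⟩ := hX.exists_cylinder hQ B T hB 0 fun _ _ => zero_le
    refine ⟨h, hh, hh1, fun s C hC => ?_⟩
    have := hP s C (by rwa [add_zero])
    rw [add_zero] at this
    rw [← this]
    congr 2
    ext ω
    simp only [Set.mem_ofPred_eq, Set.mem_iInter]
    refine forall₂_congr fun r hr => ?_
    rw [← hBf r hr]
    rfl
  | compl A hA ih =>
    obtain ⟨h, hh, hh1, hP⟩ := ih
    refine ⟨fun y => 1 - h y, measurable_const.sub hh, fun y => tsub_le_self, fun s C hC => ?_⟩
    have hfin : ∫⁻ ω in C, h (X s ω) ∂P ≠ ⊤ := hP s C hC ▸ measure_ne_top _ _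
    have hhm : Measurable fun ω => h (X s ω) := hh.comp (hX.measurable s)
    rw [lintegral_sub hhm hfin (ae_of_all _ fun ω => hh1 _), ← hP s C hC, setLIntegral_one]
    refine ENNReal.eq_sub_of_add_eq (measure_ne_top _ _) ?_
    rw [add_comm]
    exact measure_inter_add_sdiff C (hmeas hA s)
  | iUnion f hd hf ih =>
    choose h hh hh1 hP using ih
    have hsum : Measurable fun y => ∑' n, h n y := Measurable.tsum hh
    have hPsum : ∀ (s : ℝ≥0) (C : Set Ω), MeasurableSet[past X s] C →
        P (C ∩ {ω | shift s (path X ω) ∈ ⋃ n, f n}) = ∫⁻ ω in C, ∑' n, h n (X s ω) ∂P := by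
      intro s C hC
      have hhm : ∀ n, Measurable fun ω => h n (X s ω) := fun n => (hh n).comp (hX.measurable s)
      rw [lintegral_tsum fun n => (hhm n).aemeasurable]
      simp_rw [← hP _ s C hC]
      rw [← measure_iUnion]
      · congr 1
        ext ω
        simp
      · intro i j hij
        exact ((hd hij).preimage (fun ω => shift s (path X ω))).mono Set.inter_subset_right
          Set.inter_subset_right
      · exact fun n => (hX.past_le s C hC).inter (hmeas (hf n) s)
    -- The sum is at most `1` only almost everywhere under the law of each `X s`, whereas the total
    -- variation estimate needs the bound at every point. The truncation provides it without
    -- changing the integrals.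
    refine ⟨fun y => min 1 (∑' n, h n y), measurable_const.min hsum, fun y => min_le_left _ _,
      fun s C hC => ?_⟩
    rw [hPsum s C hC]
    have hle : (fun y => ∑' n, h n y) ≤ᵐ[P.map (X s)] fun _ => 1 := by
      refine ae_le_of_forall_setLIntegral_le_of_sigmaFinite hsum fun B hB _ => ?_
      rw [setLIntegral_map hB hsum (hX.measurable s),
        ← hPsum s _ (measurable_past le_rfl hB), setLIntegral_one,
        Measure.map_apply (hX.measurable s) hB]
      exact measure_mono Set.inter_subset_left
    refine lintegral_congr_ae (ae_restrict_of_ae ?_)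
    filter_upwards [ae_of_ae_map (hX.measurable s).aemeasurable hle] with ω hω
    exact (min_eq_right hω).symm

end IsMarkovProcess

end TwoTypeCBI

/-! ### Asymptotic independence and stationarity. -/

namespace TwoTypeCBI

variable {Ω : Type*} {Q : ℝ≥0 → Kernel State State} {X : ℝ≥0 → Ω → State}
  [mΩ : MeasurableSpace Ω] {P : Measure Ω}

lemma hasSum_measureReal_iUnion [IsFiniteMeasure P] {f : ℕ → Set Ω}
    (hd : Pairwise (Function.onFun Disjoint f)) (hf : ∀ n, MeasurableSet (f n)) :
    HasSum (fun n => P.real (f n)) (P.real (⋃ n, f n)) := by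
  have h := measure_iUnion (μ := P) hd hf
  rw [measureReal_def, h, ENNReal.tsum_toReal_eq fun n => measure_ne_top _ _]
  exact (ENNReal.summable_toReal (h ▸ measure_ne_top _ _)).hasSum

namespace IsMarkovProcess

lemma measurableSet_shift (hX : IsMarkovProcess P Q X) {A : Set (ℝ≥0 → State)}
    (hA : MeasurableSet A) (t : ℝ≥0) : MeasurableSet {ω | shift t (path X ω) ∈ A} :=
  ((measurable_shift t).comp hX.measurable_path) hA

variable [IsProbabilityMeasure P]

/-- The dependence of the future after `t` on the past up to `s < t` is controlled by the total
variation distances of `Q_{t - s}(X_s, ·)` and `Q_{t - s}(0, ·)`. -/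
lemma abs_measureReal_inter_sub_le (hX : IsMarkovProcess P Q X) (hQ : ∀ t, IsMarkovKernel (Q t))
    {s r : ℝ≥0} {δ : State → ℝ} (hδ : Measurable δ) (hδ1 : ∀ x, δ x ≤ 1)
    (hTV : ∀ (x : State) (f : State → ENNReal), Measurable f → (∀ y, f y ≤ 1) →
      |(∫⁻ y, f y ∂(Q r x)).toReal - (∫⁻ y, f y ∂(Q r 0)).toReal| ≤ δ x)
    {C : Set Ω} (hC : MeasurableSet[past X s] C) {A : Set (ℝ≥0 → State)} (hA : MeasurableSet A) :
    |P.real (C ∩ {ω | shift (s + r) (path X ω) ∈ A}) -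
      P.real C * P.real {ω | shift (s + r) (path X ω) ∈ A}| ≤ 2 * ∫ ω, δ (X s ω) ∂P := by
  obtain ⟨h, hh, hh1, hP⟩ := hX.exists_shift hQ hA
  have hC' := hX.past_le s C hC
  set g : State → ENNReal := fun x => ∫⁻ y, h y ∂(Q r x) with hg
  have hgm : Measurable g := hh.lintegral_kernel
  have hg1 : ∀ x, g x ≤ 1 := fun x => by
    have := hQ r
    calc g x ≤ ∫⁻ _, 1 ∂(Q r x) := lintegral_mono fun y => hh1 y
      _ = 1 := by simp
  have hGm : Measurable fun ω => g (X s ω) := hgm.comp (hX.measurable s)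
  have hreal : ∀ D, MeasurableSet[past X s] D →
      P.real (D ∩ {ω | shift (s + r) (path X ω) ∈ A}) = ∫ ω in D, (g (X s ω)).toReal ∂P := by
    intro D hD
    rw [measureReal_def, hP (s + r) D (past_mono X le_self_add D hD),
      hX.setLIntegral_comp hQ s r hD hh, integral_toReal hGm.aemeasurable
        (ae_of_all _ fun ω => (hg1 _).trans_lt ENNReal.one_lt_top)]
  have huniv := hreal Set.univ MeasurableSet.univ
  rw [Set.univ_inter, setIntegral_univ] at huniv
  have hGi : Integrable (fun ω => (g (X s ω)).toReal) P := by
    refine Integrable.of_bound hGm.ennreal_toReal.aestronglyMeasurable 1 (ae_of_all _ fun ω => ?_)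
    rw [Real.norm_of_nonneg ENNReal.toReal_nonneg]
    exact ENNReal.toReal_mono ENNReal.one_ne_top (hg1 _)
  -- Centring at the value for starting point `0`: the contributions `P(C) m` cancel, leaving two
  -- errors of size at most `∫ δ (X s)`, hence the factor `2`.
  set m := (g 0).toReal
  set d : Ω → ℝ := fun ω => (g (X s ω)).toReal - m with hd
  have hdi : Integrable d P := hGi.sub (integrable_const m)
  have hdδ : ∀ ω, |d ω| ≤ δ (X s ω) := fun ω => hTV (X s ω) h hh hh1
  have hδi : Integrable (fun ω => δ (X s ω)) P := by
    refine Integrable.of_bound (hδ.comp (hX.measurable s)).aestronglyMeasurable 1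
      (ae_of_all _ fun ω => ?_)
    rw [Real.norm_of_nonneg ((abs_nonneg _).trans (hdδ ω))]
    exact hδ1 _
  have h1 : ∫ ω in C, (g (X s ω)).toReal ∂P = ∫ ω in C, d ω ∂P + P.real C * m := by
    rw [hd, integral_sub hGi.integrableOn (integrable_const m).integrableOn, setIntegral_const,
      smul_eq_mul]
    ring
  have h2 : ∫ ω, (g (X s ω)).toReal ∂P = ∫ ω, d ω ∂P + m := by
    rw [hd, integral_sub hGi (integrable_const m)]
    simp
  have h3 : |∫ ω in C, d ω ∂P| ≤ ∫ ω, δ (X s ω) ∂P := by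
    calc |∫ ω in C, d ω ∂P| ≤ ∫ ω in C, |d ω| ∂P := abs_integral_le_integral_abs
      _ ≤ ∫ ω, |d ω| ∂P := setIntegral_le_integral hdi.abs (ae_of_all _ fun ω => abs_nonneg _)
      _ ≤ _ := integral_mono hdi.abs hδi hdδ
  have h4 : |∫ ω, d ω ∂P| ≤ ∫ ω, δ (X s ω) ∂P :=
    abs_integral_le_integral_abs.trans (integral_mono hdi.abs hδi hdδ)
  have h5 : |P.real C * ∫ ω, d ω ∂P| ≤ ∫ ω, δ (X s ω) ∂P := by
    rw [abs_mul, abs_of_nonneg measureReal_nonneg]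
    exact (mul_le_of_le_one_left (abs_nonneg _) measureReal_le_one).trans h4
  rw [hreal C hC, huniv, h1, h2]
  have e : ∫ ω in C, d ω ∂P + P.real C * m - P.real C * (∫ ω, d ω ∂P + m) =
      ∫ ω in C, d ω ∂P - P.real C * ∫ ω, d ω ∂P := by ring
  rw [e]
  refine (abs_sub _ _).trans ?_
  linarith

/-- Asymptotic independence of the past up to a fixed time and the remote future. -/
lemma tendsto_of_measurableSet_past (hX : IsMarkovProcess P Q X)
    (hQ : ∀ t, IsMarkovKernel (Q t)) {C₀ : ℝ}
    (hTV : ∀ t : ℝ≥0, 0 < t → ∀ (x : State) (f : State → ENNReal), Measurable f →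
      (∀ y, f y ≤ 1) → |(∫⁻ y, f y ∂(Q t x)).toReal - (∫⁻ y, f y ∂(Q t 0)).toReal| ≤
        1 - Real.exp (-(((x 0 : ℝ) + x 1) * (C₀ / t))))
    {s : ℝ≥0} {C : Set Ω} (hC : MeasurableSet[past X s] C) {A : ℝ≥0 → Set (ℝ≥0 → State)}
    (hA : ∀ t, MeasurableSet (A t)) :
    Tendsto (fun t => P.real (C ∩ {ω | shift t (path X ω) ∈ A t}) -
      P.real C * P.real {ω | shift t (path X ω) ∈ A t}) atTop (𝓝 0) := by
  set δ : ℝ≥0 → State → ℝ := fun r x => 1 - Real.exp (-(((x 0 : ℝ) + x 1) * (C₀ / r))) with hδ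
  have hδm : ∀ r, Measurable (δ r) := fun r => by
    simp only [hδ]
    fun_prop
  have hδ1 : ∀ r x, δ r x ≤ 1 := fun r x => by
    simp only [hδ]
    linarith [Real.exp_pos (-(((x 0 : ℝ) + x 1) * (C₀ / r)))]
  have hδ0 : ∀ r, 0 < r → ∀ x, 0 ≤ δ r x := fun r hr x =>
    (abs_nonneg _).trans (hTV r hr x (fun _ => 0) measurable_const fun _ => zero_le)
  have hsub : Tendsto (fun t : ℝ≥0 => t - s) atTop atTop :=
    tendsto_atTop.2 fun b => by
      filter_upwards [eventually_ge_atTop (b + s)] with t ht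
      exact le_tsub_of_add_le_right ht
  -- Since `δ ≤ 1`, dominated convergence applies for any initial law, with no moment of `X s`. The
  -- bound does not involve `A t`, which may therefore vary with `t`.
  have hlim : Tendsto (fun t : ℝ≥0 => 2 * ∫ ω, δ (t - s) (X s ω) ∂P) atTop (𝓝 0) := by
    have h := tendsto_integral_filter_of_dominated_convergence (μ := P) (l := atTop)
      (F := fun (t : ℝ≥0) ω => δ (t - s) (X s ω)) (f := fun _ => (0 : ℝ)) (fun _ => 1)
      (Eventually.of_forall fun t => ((hδm _).comp (hX.measurable s)).aestronglyMeasurable)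
      (by
        filter_upwards [eventually_gt_atTop s] with t ht
        refine ae_of_all _ fun ω => ?_
        rw [Real.norm_of_nonneg (hδ0 _ (tsub_pos_of_lt ht) _)]
        exact hδ1 _ _) (integrable_const 1)
      (ae_of_all _ fun ω => by
        have h1 : Tendsto (fun t : ℝ≥0 => C₀ / ((t - s : ℝ≥0) : ℝ)) atTop (𝓝 0) :=
          tendsto_const_nhds.div_atTop (NNReal.tendsto_coe_atTop.2 hsub)
        have h2 : Continuous fun z : ℝ =>
            1 - Real.exp (-(((X s ω 0 : ℝ) + X s ω 1) * z)) := by fun_prop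
        have h3 := (h2.tendsto 0).comp h1
        simp only [mul_zero, neg_zero, Real.exp_zero, sub_self] at h3
        exact h3)
    simpa using h.const_mul 2
  refine squeeze_zero_norm' ?_ hlim
  filter_upwards [eventually_gt_atTop s] with t ht
  have := hX.abs_measureReal_inter_sub_le hQ (hδm (t - s)) (hδ1 (t - s))
    (hTV _ (tsub_pos_of_lt ht)) hC (hA t)
  rwa [add_tsub_cancel_of_le ht.le] at this

/-- Asymptotic independence of an event of the process and the remote future. -/
lemma tendsto_of_measurableSet_iSup (hX : IsMarkovProcess P Q X) {A : ℝ≥0 → Set (ℝ≥0 → State)}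
    (hA : ∀ t, MeasurableSet (A t))
    (hpast : ∀ (s : ℝ≥0) (C : Set Ω), MeasurableSet[past X s] C →
      Tendsto (fun t => P.real (C ∩ {ω | shift t (path X ω) ∈ A t}) -
        P.real C * P.real {ω | shift t (path X ω) ∈ A t}) atTop (𝓝 0))
    {C : Set Ω} (hC : MeasurableSet[⨆ s, MeasurableSpace.comap (X s) inferInstance] C) :
    Tendsto (fun t => P.real (C ∩ {ω | shift t (path X ω) ∈ A t}) -
      P.real C * P.real {ω | shift t (path X ω) ∈ A t}) atTop (𝓝 0) := by
  have hle : ⨆ s, MeasurableSpace.comap (X s) inferInstance ≤ mΩ :=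
    iSup_le fun s => (hX.measurable s).comap_le
  set F : ℝ≥0 → Set Ω := fun t => {ω | shift t (path X ω) ∈ A t} with hF
  have hFm : ∀ t, MeasurableSet (F t) := fun t => hX.measurableSet_shift (hA t) t
  induction C, hC using MeasurableSpace.induction_on_inter (h_eq := generateFrom_cylinders X) with
  | h_inter => exact isPiSystem_piiUnionInter _ (fun s =>
      @MeasurableSpace.isPiSystem_measurableSet _ (MeasurableSpace.comap _ _)) _
  | empty => simp
  | basic C hC =>
    obtain ⟨T, -, f, hf, rfl⟩ := hC
    refine hpast (T.sup id) _ ?_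
    refine @Finset.measurableSet_biInter _ _ (past X (T.sup id)) _ T fun r hr => ?_
    exact (le_iSup₂_of_le r (Finset.le_sup (f := id) hr) le_rfl :
      MeasurableSpace.comap (X r) inferInstance ≤ past X (T.sup id)) _ (hf r hr)
  | compl C hC ih =>
    have hC' := hle C hC
    have := ih.neg
    rw [neg_zero] at this
    refine this.congr fun t => ?_
    have h1 := measureReal_inter_add_sdiff (μ := P) (s := F t) hC'
    have h2 : Cᶜ ∩ F t = F t \ C := by rw [Set.inter_comm, Set.sdiff_eq]
    rw [Set.inter_comm] at h1
    rw [h2, probReal_compl_eq_one_sub hC']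
    linarith
  | iUnion f hd hf ih =>
    have hf' : ∀ n, MeasurableSet (f n) := fun n => hle _ (hf n)
    have hsum : HasSum (fun n => P.real (f n)) (P.real (⋃ n, f n)) :=
      hasSum_measureReal_iUnion hd hf'
    have hsum' : ∀ t, HasSum (fun n => P.real (f n ∩ F t)) (P.real ((⋃ n, f n) ∩ F t)) := by
      intro t
      rw [Set.iUnion_inter]
      exact hasSum_measureReal_iUnion
        (fun i j hij => (hd hij).mono Set.inter_subset_left Set.inter_subset_left)
        fun n => (hf' n).inter (hFm t)
    -- Each defect is at most `P (f n)` in absolute value, summably in `n` and uniformly in `t`, so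
    -- limit and sum may be interchanged.
    have hlim := tendsto_tsum_of_dominated_convergence (𝓕 := atTop) hsum.summable ih
      (Eventually.of_forall fun t n => by
        have h1 : P.real (f n ∩ F t) ≤ P.real (f n) := measureReal_mono Set.inter_subset_left
        have h2 : P.real (f n) * P.real (F t) ≤ P.real (f n) :=
          mul_le_of_le_one_right measureReal_nonneg measureReal_le_one
        have h3 : 0 ≤ P.real (f n) * P.real (F t) := by positivity
        have h4 : 0 ≤ P.real (f n ∩ F t) := measureReal_nonneg
        rw [Real.norm_eq_abs, abs_le]
        constructor <;> linarith)
    rw [tsum_zero] at hlim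
    refine hlim.congr fun t => ?_
    exact ((hsum' t).sub (hsum.mul_right _)).tsum_eq

/-- A Markov process started from a stationary distribution has a shift invariant law. -/
lemma measurePreserving_shift (hX : IsMarkovProcess P Q X) (hQ : ∀ t, IsMarkovKernel (Q t))
    (hstat : ∀ t, (P.map (X 0)).bind (Q t) = P.map (X 0)) (t : ℝ≥0) :
    MeasurePreserving (shift t) (P.map (path X)) (P.map (path X)) := by
  have hmap : ∀ t, P.map (X t) = P.map (X 0) := fun t => by
    rw [← hstat t]
    ext A hA
    rw [Measure.map_apply (hX.measurable t) hA, Measure.bind_apply hA (Q t).aemeasurable,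
      lintegral_map ((Q t).measurable_coe hA) (hX.measurable 0)]
    simpa using hX.measure_inter_preimage hQ 0 t (C := Set.univ) MeasurableSet.univ hA
  refine ⟨measurable_shift t, ?_⟩
  ext A hA
  obtain ⟨h, hh, -, hP⟩ := hX.exists_shift hQ hA
  -- The function `h` does not depend on `s`, and by stationarity neither does the law of `X s`.
  have key : ∀ s, P {ω | shift s (path X ω) ∈ A} = ∫⁻ y, h y ∂(P.map (X 0)) := fun s => by
    have := hP s Set.univ MeasurableSet.univ
    rw [Set.univ_inter, setLIntegral_univ] at this
    rw [this, ← hmap s, lintegral_map hh (hX.measurable s)]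
  rw [Measure.map_apply (measurable_shift t) hA,
    Measure.map_apply hX.measurable_path (measurable_shift t hA),
    Measure.map_apply hX.measurable_path hA]
  have h0 := key 0
  have e : {ω | shift 0 (path X ω) ∈ A} = path X ⁻¹' A := by
    ext ω
    simp only [Set.mem_ofPred_eq, Set.mem_preimage]
    have : shift 0 (path X ω) = path X ω := by
      funext s
      simp [shift]
    rw [this]
  rw [e] at h0
  rw [h0]
  exact key t

end IsMarkovProcess

end TwoTypeCBI

/-! ### Mixing and tail triviality. -/

theorem corollary2p3 (θ : TwoTypeCBI.Params)
    (hB : ∀ μ : ℝ, Module.End.HasEigenvalue (Matrix.toLin' θ.B) μ → 0 < μ)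
    (Q : ℝ≥0 → Kernel TwoTypeCBI.State TwoTypeCBI.State) (hQ : θ.IsTransitionSemigroup Q)
    {Ω : Type*} [MeasurableSpace Ω] (P : Measure Ω) [IsProbabilityMeasure P]
    (X : ℝ≥0 → Ω → TwoTypeCBI.State) (hX : TwoTypeCBI.IsMarkovProcess P Q X) :
    TwoTypeCBI.IsMixing P X ∧
    ((∀ t, (P.map (X 0)).bind (Q t) = P.map (X 0)) →
      TwoTypeCBI.IsShiftMixing (P.map (TwoTypeCBI.path X))) ∧
    ∀ E : Set Ω, MeasurableSet[TwoTypeCBI.tail X] E → P E = 0 ∨ P E = 1 := by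
  obtain ⟨C₀, -, hTV⟩ := hQ.exists_abs_lintegral_sub_le (θ.det_pos_of_eigenvalue_pos hB)
  have hasymp : ∀ A : ℝ≥0 → Set (ℝ≥0 → TwoTypeCBI.State), (∀ t, MeasurableSet (A t)) →
      ∀ C, MeasurableSet[⨆ s, MeasurableSpace.comap (X s) inferInstance] C →
      Tendsto (fun t => P.real (C ∩ {ω | TwoTypeCBI.shift t (TwoTypeCBI.path X ω) ∈ A t}) -
        P.real C * P.real {ω | TwoTypeCBI.shift t (TwoTypeCBI.path X ω) ∈ A t}) atTop (𝓝 0) :=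
    fun A hA C hC => hX.tendsto_of_measurableSet_iSup hA
      (fun s D hD => hX.tendsto_of_measurableSet_past hQ.markov hTV hD hA) hC
  have hmix : TwoTypeCBI.IsMixing P X := fun C E hC hE => by
    refine hasymp (fun _ => E) (fun _ => hE) {ω | TwoTypeCBI.path X ω ∈ C} ?_
    rw [← TwoTypeCBI.comap_path]
    exact ⟨C, hC, rfl⟩
  refine ⟨hmix, fun hstat => ?_, fun E hE => ?_⟩
  · have hpres := hX.measurePreserving_shift hQ.markov hstat
    refine ⟨hpres, fun C E hC hE => ?_⟩
    have hpath := hX.measurable_path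
    have hμ : IsProbabilityMeasure (P.map (TwoTypeCBI.path X)) :=
      Measure.isProbabilityMeasure_map hpath.aemeasurable
    set μ := P.map (TwoTypeCBI.path X) with hμdef
    -- Under stationarity the second factor is constant in `t`, so vanishing of the difference
    -- becomes convergence to the product.
    have hconst : ∀ t, P.real {ω | TwoTypeCBI.shift t (TwoTypeCBI.path X ω) ∈ E} = μ.real E :=
      fun t => by
        rw [measureReal_def, measureReal_def, ← (hpres t).measure_preimage hE.nullMeasurableSet,
          hμdef, Measure.map_apply hpath ((hpres t).measurable hE)]
        rfl
    have hCμ : P.real {ω | TwoTypeCBI.path X ω ∈ C} = μ.real C := by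
      rw [measureReal_def, measureReal_def, hμdef, Measure.map_apply hpath hC]
      rfl
    have hreal : Tendsto (fun t => μ.real (C ∩ TwoTypeCBI.shift t ⁻¹' E)) atTop
        (𝓝 (μ.real C * μ.real E)) := by
      have h := (hmix C E hC hE).add_const (μ.real C * μ.real E)
      rw [zero_add] at h
      refine h.congr fun t => ?_
      rw [hconst, hCμ, sub_add_cancel, measureReal_def, measureReal_def, hμdef,
        Measure.map_apply hpath (hC.inter ((hpres t).measurable hE))]
      rfl
    rw [← ENNReal.tendsto_toReal_iff (fun t => measure_ne_top _ _)
      (ENNReal.mul_ne_top (measure_ne_top _ _) (measure_ne_top _ _)), ENNReal.toReal_mul]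
    exact hreal
  · have hfut : ∀ t, MeasurableSet[⨆ s : ℝ≥0, ⨆ _ : t ≤ s,
        MeasurableSpace.comap (X s) inferInstance] E := fun t =>
      (iInf_le (fun t : ℝ≥0 => ⨆ s : ℝ≥0, ⨆ _ : t ≤ s,
        MeasurableSpace.comap (X s) inferInstance) t) E hE
    choose A hA hEA using fun t => TwoTypeCBI.exists_shift_of_measurableSet_future (hfut t)
    have hEσ : MeasurableSet[⨆ s, MeasurableSpace.comap (X s) inferInstance] E :=
      (iSup₂_le fun s _ => le_iSup (fun s => MeasurableSpace.comap (X s) inferInstance) s :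
        (⨆ s : ℝ≥0, ⨆ _ : (0 : ℝ≥0) ≤ s, MeasurableSpace.comap (X s) inferInstance) ≤ _) E (hfut 0)
    -- The tail event is both the fixed event and the future event, represented through a set `A t`
    -- of shifted paths for each `t`. The expression is then the constant `P(E) - P(E)²`, which must
    -- equal its limit `0`.
    have h := hasymp A hA E hEσ
    simp_rw [← hEA, Set.inter_self] at h
    have h0 : P.real E - P.real E * P.real E = 0 := tendsto_nhds_unique tendsto_const_nhds h
    have h1 : P.real E * (1 - P.real E) = 0 := by linarith
    rcases mul_eq_zero.1 h1 with h2 | h2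
    · left
      rwa [measureReal_eq_zero_iff] at h2
    · right
      have h3 : P.real E = 1 := by linarith
      rw [measureReal_def] at h3
      rwa [← ENNReal.toReal_eq_one_iff]
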